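/- Let $n\ge 0$, let $M$ be a real symmetric positive definite $n\times n$ matrix, and for $V\in C^\infty(\mathbb R^n)$ let $H(q,p)=T(p)+V(q)$ with $T=\tfrac12 p^{T}Mp$, $(q,p)\in\mathbb R^n\times\mathbb R^n$. Write $\partial_a=\partial/\partial q^a$ (at fixed $p$), $\partial^a=\sum_b M^{ab}\partial_b$, $D=\sum_a p_a\partial^a$, $\bar D=\sum_a(\partial_aV)\partial^a$ and $\bar D_3=\sum_{a,b,c}(\partial_aV)(\partial_bV)(\partial_cV)\,\partial^a\partial^b\partial^c$; products of $D$ and $\bar D$ are compositions of operators. Put $$T_2=-\tfrac1{12}D^2V,\qquad V_2=\tfrac1{24}\bar DV,$$ $$T_4=\tfrac1{720}\left(D^4-9\bar DD^2+3D\bar DD\right)V,\qquad V_4=\tfrac1{480}\bar D^2V,$$ $$T_6=-\tfrac1{60480}\left(2D^6-40\bar DD^4+46D\bar DD^3-15D^2\bar DD^2+54\bar D^2D^2-9\bar DD\bar DD-42D\bar D^2D+12D^2\bar D^2\right)V,$$ $$V_6=\tfrac1{161280}\left(17\bar D^3-10\bar D_3\right)V.$$ For $K\in\{1,2,3\}$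 let $T_{\rm eff}=T+\sum_{k=1}^K\tau^{2k}T_{2k}$ and $V_{\rm eff}=V+\sum_{k=1}^K\tau^{2k}V_{2k}$. One step of length $\tau$ of the modified kick-move-kick scheme is: follow the Hamiltonian flow of $V_{\rm eff}$ for time $\tau/2$, then that of $T_{\rm eff}$ for time $\tau$, then that of $V_{\rm eff}$ for time $\tau/2$ (with $\tau$ fixed in $V_{\rm eff}$ and $T_{\rm eff}$). Let $N=2K+2$, so that $N=4,6,8$ respectively. (1) For every $V\in C^\infty(\mathbb R^n)$ and every compact set $S\subset\mathbb R^{2n}$ there are $\tau_0>0$ and $C$ such that, for all $z\in S$ and $|\tau|\le\tau_0$, both the modified step and the exact flow of $H$ for time $\tau$ are defined and unique at $z$, and their results differ by at most $C|\tau|^{N+1}$; that is, the scheme agrees with the exact flow to order $\tau^N$. (2) The method has order $N$: for every $V\in C^\infty(\mathbb R^n)$ and every solution $\gamma$ of Hamilton's equations of $H$ on an interval $[0,t]$ there are $\tau_0>0$ and $C$ such that for $0<\tau\le\tau_0$ the iterates $x_0=\gamma(0)$, $x_{k+1}=$ (modified step of length $\tau$ from $x_k$) exist as long as they are within $[0,t]$,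 and $\|x_k-\gamma(k\tau)\|\le C\tau^N$ for all $k\ge0$ with $k\tau\le t$. (3) In general the two differ in the terms of order $\tau^{N+1}$: for every $M$ as above with $n\ge1$ there are $V\in C^\infty(\mathbb R^n)$, a point $z$ and constants $c,\tau_0>0$ such that for $0<|\tau|\le\tau_0$ the results of the modified step and of the exact flow from $z$ differ by at least $c|\tau|^{N+1}$. -/

import Mathlib

open scoped ContDiff

noncomputable section

namespace ModifiedSplitting

/-- Phase space: a point is a pair `(q, p)` of positions and momenta.  The norm on it is the sup norm;
it is only used in estimates up to a constant factor. -/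
abbrev Phase (n : ℕ) : Type := (Fin n → ℝ) × (Fin n → ℝ)

variable {n : ℕ}

/-- `∂_a = ∂/∂q^a`, at fixed `p`. -/
def dq (a : Fin n) (f : Phase n → ℝ) : Phase n → ℝ :=
  fun z => fderiv ℝ f z (Pi.single a 1, 0)

/-- `∂/∂p_a`, at fixed `q`. -/
def dp (a : Fin n) (f : Phase n → ℝ) : Phase n → ℝ :=
  fun z => fderiv ℝ f z (0, Pi.single a 1)

/-- `∂^a = M^{ab} ∂_b`. -/
def dqUp (M : Matrix (Fin n) (Fin n) ℝ) (a : Fin n) (f : Phase n → ℝ) : Phase n → ℝ :=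
  fun z => ∑ b, M a b * dq b f z

/-- `D = p_a ∂^a`. -/
def D (M : Matrix (Fin n) (Fin n) ℝ) (f : Phase n → ℝ) : Phase n → ℝ :=
  fun z => ∑ a, z.2 a * dqUp M a f z

/-- `D̄ = (∂_a U) ∂^a`, where `U` is the potential. -/
def Dbar (M : Matrix (Fin n) (Fin n) ℝ) (U f : Phase n → ℝ) : Phase n → ℝ :=
  fun z => ∑ a, dq a U z * dqUp M a f z

/-- `D̄₃ = (∂_a U) (∂_b U) (∂_c U) ∂^a ∂^b ∂^c`: the derivatives do not act on the prefactors. -/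
def Dbar3 (M : Matrix (Fin n) (Fin n) ℝ) (U f : Phase n → ℝ) : Phase n → ℝ :=
  fun z => ∑ a, ∑ b, ∑ c,
    dq a U z * dq b U z * dq c U z * dqUp M a (dqUp M b (dqUp M c f)) z

/-- The potential `V(q)` as a function on phase space. -/
def pot (V : (Fin n → ℝ) → ℝ) : Phase n → ℝ := fun z => V z.1

/-- The kinetic energy `T = ½ pᵀ M p`. -/
def kin (M : Matrix (Fin n) (Fin n) ℝ) : Phase n → ℝ :=
  fun z => (1 / 2) * (z.2 ⬝ᵥ (M.mulVec z.2))

/-- The Hamiltonian `H = ½ pᵀ M p + V(q)`. -/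
def ham (M : Matrix (Fin n) (Fin n) ℝ) (V : (Fin n → ℝ) → ℝ) : Phase n → ℝ :=
  fun z => kin M z + pot V z

/-- `T₂ = -D²V / 12`. -/
def T2 (M : Matrix (Fin n) (Fin n) ℝ) (V : (Fin n → ℝ) → ℝ) : Phase n → ℝ :=
  fun z => -(1 / 12) * D M (D M (pot V)) z

/-- `V₂ = D̄V / 24`. -/
def V2 (M : Matrix (Fin n) (Fin n) ℝ) (V : (Fin n → ℝ) → ℝ) : Phase n → ℝ :=
  fun z => (1 / 24) * Dbar M (pot V) (pot V) z

/-- `T₄ = (D⁴ - 9 D̄D² + 3 DD̄D) V / 720`. -/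
def T4 (M : Matrix (Fin n) (Fin n) ℝ) (V : (Fin n → ℝ) → ℝ) : Phase n → ℝ :=
  let d := D M
  let e := Dbar M (pot V)
  let U := pot V
  fun z => (1 / 720) *
    (d (d (d (d U))) z - 9 * e (d (d U)) z + 3 * d (e (d U)) z)

/-- `V₄ = D̄²V / 480`. -/
def V4 (M : Matrix (Fin n) (Fin n) ℝ) (V : (Fin n → ℝ) → ℝ) : Phase n → ℝ :=
  let e := Dbar M (pot V)
  fun z => (1 / 480) * e (e (pot V)) z

/-- `T₆ = -(2D⁶ - 40 D̄D⁴ + 46 DD̄D³ - 15 D²D̄D² + 54 D̄²D² - 9 D̄DD̄D - 42 DD̄²D + 12 D²D̄²) V / 60480`. -/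
def T6 (M : Matrix (Fin n) (Fin n) ℝ) (V : (Fin n → ℝ) → ℝ) : Phase n → ℝ :=
  let d := D M
  let e := Dbar M (pot V)
  let U := pot V
  fun z => -(1 / 60480) *
    (2 * d (d (d (d (d (d U))))) z
      - 40 * e (d (d (d (d U)))) z
      + 46 * d (e (d (d (d U)))) z
      - 15 * d (d (e (d (d U)))) z
      + 54 * e (e (d (d U))) z
      - 9 * e (d (e (d U))) z
      - 42 * d (e (e (d U))) z
      + 12 * d (d (e (e U))) z)

/-- `V₆ = (17 D̄³ - 10 D̄₃) V / 161280`. -/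
def V6 (M : Matrix (Fin n) (Fin n) ℝ) (V : (Fin n → ℝ) → ℝ) : Phase n → ℝ :=
  let e := Dbar M (pot V)
  let U := pot V
  fun z => (1 / 161280) * (17 * e (e (e U)) z - 10 * Dbar3 M U U z)

/-- The corrections `T_{2k}` for `k = 1, 2, 3`. -/
def Tcorr (M : Matrix (Fin n) (Fin n) ℝ) (V : (Fin n → ℝ) → ℝ) : ℕ → Phase n → ℝ
  | 1 => T2 M V
  | 2 => T4 M V
  | 3 => T6 M V
  | _ => 0

/-- The corrections `V_{2k}` for `k = 1, 2, 3`. -/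
def Vcorr (M : Matrix (Fin n) (Fin n) ℝ) (V : (Fin n → ℝ) → ℝ) : ℕ → Phase n → ℝ
  | 1 => V2 M V
  | 2 => V4 M V
  | 3 => V6 M V
  | _ => 0

/-- `T + ∑_{k=1}^K τ^{2k} T_{2k}`. -/
def Teff (M : Matrix (Fin n) (Fin n) ℝ) (V : (Fin n → ℝ) → ℝ) (K : ℕ) (τ : ℝ) : Phase n → ℝ :=
  fun z => kin M z + ∑ k ∈ Finset.Icc 1 K, τ ^ (2 * k) * Tcorr M V k z

/-- `V + ∑_{k=1}^K τ^{2k} V_{2k}`. -/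
def Veff (M : Matrix (Fin n) (Fin n) ℝ) (V : (Fin n → ℝ) → ℝ) (K : ℕ) (τ : ℝ) : Phase n → ℝ :=
  fun z => pot V z + ∑ k ∈ Finset.Icc 1 K, τ ^ (2 * k) * Vcorr M V k z

/-- The Hamiltonian vector field `(∂H/∂p, -∂H/∂q)`. -/
def hamVF (H : Phase n → ℝ) (z : Phase n) : Phase n :=
  (fun a => dp a H z, fun a => -dq a H z)

/-- `γ` solves Hamilton's equations of `H` on the time interval between `0` and `t`
(`t` may be negative). -/
def IsSolution (H : Phase n → ℝ) (t : ℝ) (γ : ℝ → Phase n) : Prop :=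
  ∀ s ∈ Set.uIcc 0 t, HasDerivWithinAt γ (hamVF H (γ s)) (Set.uIcc 0 t) s

/-- The Hamiltonian flow of `H` carries `z` to `w` in time `t`. -/
def FlowsTo (H : Phase n → ℝ) (t : ℝ) (z w : Phase n) : Prop :=
  ∃ γ : ℝ → Phase n, IsSolution H t γ ∧ γ 0 = z ∧ γ t = w

/-- One complete time step `τ` of the modified kick-move-kick scheme carries `z` to `w`. -/
def Step (M : Matrix (Fin n) (Fin n) ℝ) (V : (Fin n → ℝ) → ℝ) (K : ℕ) (τ : ℝ)
    (z w : Phase n) : Prop :=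
  ∃ z₁ z₂ : Phase n,
    FlowsTo (Veff M V K τ) (τ / 2) z z₁ ∧
    FlowsTo (Teff M V K τ) τ z₁ z₂ ∧
    FlowsTo (Veff M V K τ) (τ / 2) z₂ w

/-- `x 0, x 1, …` is the numerical solution with time step `τ` started at `z`, up to time `t`. -/
def IsNumericalSolution (M : Matrix (Fin n) (Fin n) ℝ) (V : (Fin n → ℝ) → ℝ) (K : ℕ) (τ t : ℝ)
    (z : Phase n) (x : ℕ → Phase n) : Prop :=
  x 0 = z ∧ ∀ k : ℕ, ((k : ℝ) + 1) * τ ≤ t → Step M V K τ (x k) (x (k + 1))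

/-- In one time step the scheme agrees with the exact flow through the terms of order `τ^N`,
uniformly on compact sets. -/
def AgreesToOrder (M : Matrix (Fin n) (Fin n) ℝ) (V : (Fin n → ℝ) → ℝ) (K N : ℕ) : Prop :=
  ∀ S : Set (Phase n), IsCompact S → ∃ τ₀ > (0 : ℝ), ∃ C : ℝ, ∀ z ∈ S, ∀ τ : ℝ, |τ| ≤ τ₀ →
    (∃! w, Step M V K τ z w) ∧ (∃! w, FlowsTo (ham M V) τ z w) ∧
    ∀ w w', Step M V K τ z w → FlowsTo (ham M V) τ z w' → ‖w - w'‖ ≤ C * |τ| ^ (N + 1)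

/-- The method has order `N`: along every exact solution on a finite time interval
the global error is `O(τ^N)`. -/
def HasOrder (M : Matrix (Fin n) (Fin n) ℝ) (V : (Fin n → ℝ) → ℝ) (K N : ℕ) : Prop :=
  ∀ (t : ℝ) (γ : ℝ → Phase n), 0 ≤ t → IsSolution (ham M V) t γ →
    ∃ τ₀ > (0 : ℝ), ∃ C : ℝ, ∀ τ : ℝ, 0 < τ → τ ≤ τ₀ →
      (∃ x, IsNumericalSolution M V K τ t (γ 0) x) ∧
      ∀ x, IsNumericalSolution M V K τ t (γ 0) x →
        ∀ k : ℕ, (k : ℝ) * τ ≤ t → ‖x k - γ (k * τ)‖ ≤ C * τ ^ N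

/-- The scheme differs from the exact flow in the terms of order `τ^(N+1)`, at some initial point. -/
def DiffersAfterOrder (M : Matrix (Fin n) (Fin n) ℝ) (V : (Fin n → ℝ) → ℝ) (K N : ℕ) : Prop :=
  ∃ z : Phase n, ∃ c > (0 : ℝ), ∃ τ₀ > (0 : ℝ), ∀ τ : ℝ, 0 < |τ| → |τ| ≤ τ₀ →
    ∃ w w', Step M V K τ z w ∧ FlowsTo (ham M V) τ z w' ∧ c * |τ| ^ (N + 1) ≤ ‖w - w'‖

end ModifiedSplitting

end

/-!
# Modified kick-move-kick schemes of orders four, six and eight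

Smooth functions on phase space form a Poisson algebra `Sm n`, and the derivative of a function
along the Hamiltonian flow of `f` is given by the derivation `L f = {·, f}`.  A flow for a short time
`t` therefore acts on functions as `exp (t L f)` up to a Taylor remainder
(`exists_flow_expansion`), and the local error of the scheme is governed by the coefficients of the
formal power series `E = exp W * exp B * exp W` over the noncommutative ring of operators on `Sm n`.
Here `B = ∑ X ^ (2 k + 1) L T_{2k}` generates the move and `W = ½ ∑ X ^ (2 k + 1) L V_{2k}` half of
a kick, and `E` has to agree with `exp (X L H)` up to the order of the method.

The comparison avoids the Baker-Campbell-Hausdorff series.  Since potentials commute with each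
other and `T` is quadratic in the momenta, `[W, W'] = 0` and `ad_W ^ 3 (L H) = 0`.  Hence `E`
satisfies `E' = (L H) E + exp W * Z * exp B * exp W` with the explicit defect
`Z = ∑ ad_B ^ j B' / (j + 1)! + ∑ ad_B ^ j W' / j! - (L H - W' - [W, L H] + ½ [W, [W, L H]])`
(`derivative_symmProd`), and `E` agrees with `exp (X L H)` as far as the coefficients of `Z` vanish.
The symmetry `E(X) E(-X) = 1` makes every coefficient of odd index in `Z` vanish as soon as the
preceding ones do, so that only the coefficients of even index need to be computed
(`isExpUpTo_symmProd`).

Each coefficient of `Z` is the derivation `L` of an explicit function.  With `U_i = D ^ i V`,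
`Γ(f, g) = ∂_a f ∂^a g` and `Λ(f; g, h) = ∂^a ∂^b f ∂_a g ∂_b h`, all Poisson brackets that occur are
linear combinations of the `U_i`, the `Γ(U_i, U_j)`, the `Λ(U_i; U_j, U_k)` and two terms of degree
four in `V`, because `∂U_i/∂p_a = i ∂^a U_{i-1}`.  For the given corrections these combinations
cancel (`defectSeq_zero`, `defectSeq_two`, `defectSeq_four`, `defectSeq_six`).

Uniform Picard-Lindelöf estimates turn the formal agreement into the local error bound
(`exists_local_error`), and the global error follows from Gronwall's inequality for the exact flow
(`hasOrder`).  For sharpness, let `V = ½ qᵀ M⁻¹ q`.  Then `V_eff` is a multiple of `V`, and `T_eff` is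
`T` times the Taylor polynomial of `sin τ / τ`; from a point with `q = 0` the position after one step
is the Taylor polynomial of `sin τ` times `M p`, whereas the exact one is `sin τ M p`
(`differsAfterOrder_oscillator`).
-/


noncomputable section

open scoped ContDiff

namespace ModifiedSplitting

/-! ### Truncated exponentials of noncommutative polynomials -/

section Formal

open Polynomial Finset

/-- `B ^ k / k!`. -/
def expTerm {A : Type*} [Ring A] [Algebra ℝ A] (B : A) (k : ℕ) : A :=
  ((k.factorial : ℝ)⁻¹) • B ^ k

/-- The exponential series of `B`, cut off after the term `B ^ N / N!`. -/
def expTrunc {A : Type*} [Ring A] [Algebra ℝ A] (N : ℕ) (B : A) : A :=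
  ∑ k ∈ range (N + 1), expTerm B k

/-- The iterated commutator `[B, [B, …, [B, Y]]]`. -/
def adPow {A : Type*} [Ring A] (B Y : A) : ℕ → A
  | 0 => Y
  | j + 1 => ⁅B, adPow B Y j⁆

/-- The series `∑ ad_B ^ j Y / j!` of `exp B * Y * exp (-B)`, cut off after `j = N`. -/
def conjTrunc {A : Type*} [Ring A] [Algebra ℝ A] (N : ℕ) (B Y : A) : A :=
  ∑ j ∈ range (N + 1), ((j.factorial : ℝ)⁻¹) • adPow B Y j

/-- The series `∑ ad_B ^ j Y / (j + 1)!`, cut off after `j = N`.  For `Y = B'` this is the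
logarithmic derivative of `exp B`. -/
def dexpTrunc {A : Type*} [Ring A] [Algebra ℝ A] (N : ℕ) (B Y : A) : A :=
  ∑ j ∈ range (N + 1), (((j + 1).factorial : ℝ)⁻¹) • adPow B Y j

section Ring

variable {A : Type*} [Ring A]

lemma commutator_zero (a : A) : ⁅a, (0 : A)⁆ = 0 := by simp [Ring.lie_def]

lemma commutator_add (a b c : A) : ⁅a, b + c⁆ = ⁅a, b⁆ + ⁅a, c⁆ := by
  simp only [Ring.lie_def, mul_add, add_mul]; abel

lemma commutator_sub (a b c : A) : ⁅a, b - c⁆ = ⁅a, b⁆ - ⁅a, c⁆ := by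
  simp only [Ring.lie_def, mul_sub, sub_mul]; abel

variable [Algebra ℝ A]

lemma commutator_smul (r : ℝ) (a b : A) : ⁅a, r • b⁆ = r • ⁅a, b⁆ := by
  simp only [Ring.lie_def, mul_smul_comm, smul_mul_assoc, smul_sub]

@[simp] lemma expTerm_zero (B : A) : expTerm B 0 = 1 := by simp [expTerm]

lemma mul_expTerm (B : A) (k : ℕ) : B * expTerm B k = ((k : ℝ) + 1) • expTerm B (k + 1) := by
  have h : ((k : ℝ) + 1) ≠ 0 := by positivity
  rw [expTerm, expTerm, mul_smul_comm, ← pow_succ', smul_smul, Nat.factorial_succ]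
  congr 1
  push_cast
  field_simp

/-- The two index shifts of a sum over an antidiagonal, weighted by the indices, add up to a
multiple of the next antidiagonal sum. -/
lemma sum_antidiagonal_weighted (f : ℕ → ℕ → A) (k : ℕ) :
    ∑ x ∈ antidiagonal k, (((x.2 : ℝ) + 1) • f x.1 (x.2 + 1) + ((x.1 : ℝ) + 1) • f (x.1 + 1) x.2)
      = ((k : ℝ) + 1) • ∑ x ∈ antidiagonal (k + 1), f x.1 x.2 := by
  have h1 : ∑ x ∈ antidiagonal (k + 1), (x.2 : ℝ) • f x.1 x.2
      = ∑ x ∈ antidiagonal k, ((x.2 : ℝ) + 1) • f x.1 (x.2 + 1) := by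
    rw [Finset.Nat.sum_antidiagonal_succ']; simp
  have h2 : ∑ x ∈ antidiagonal (k + 1), (x.1 : ℝ) • f x.1 x.2
      = ∑ x ∈ antidiagonal k, ((x.1 : ℝ) + 1) • f (x.1 + 1) x.2 := by
    rw [Finset.Nat.sum_antidiagonal_succ]; simp
  rw [sum_add_distrib, ← h1, ← h2, ← sum_add_distrib, smul_sum]
  refine sum_congr rfl fun x hx => ?_
  have h := mem_antidiagonal.1 hx
  rw [← add_smul, ← Nat.cast_add, add_comm x.2, h]
  push_cast
  rfl

lemma expTerm_mul (B Y : A) (k : ℕ) :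
    expTerm B k * Y = ∑ x ∈ antidiagonal k,
      (((x.1.factorial : ℝ)⁻¹) • adPow B Y x.1) * expTerm B x.2 := by
  induction k with
  | zero => simp [adPow]
  | succ k ih =>
    have h : ((k : ℝ) + 1) ≠ 0 := by positivity
    refine smul_right_injective A h ?_
    beta_reduce
    rw [← smul_mul_assoc, ← mul_expTerm, mul_assoc, ih, mul_sum,
      ← sum_antidiagonal_weighted
        (fun j l => (((j.factorial : ℝ)⁻¹) • adPow B Y j) * expTerm B l)]
    refine sum_congr rfl fun x _ => ?_
    have hj : ((x.1 : ℝ) + 1) ≠ 0 := by positivity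
    rw [← mul_smul_comm ((x.2 : ℝ) + 1), ← mul_expTerm, ← smul_mul_assoc ((x.1 : ℝ) + 1), smul_smul,
      Nat.factorial_succ, adPow, Ring.lie_def]
    push_cast
    rw [mul_inv, mul_inv_cancel_left₀ hj]
    simp only [smul_mul_assoc, mul_smul_comm, sub_mul, mul_assoc, smul_sub]
    abel

lemma sum_expTerm_mul_expTerm_neg (B : A) (k : ℕ) :
    ∑ x ∈ antidiagonal (k + 1), expTerm B x.1 * expTerm (-B) x.2 = 0 := by
  have h := (Commute.neg_right (Commute.refl B)).add_pow' (k + 1)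
  rw [add_neg_cancel, zero_pow (Nat.succ_ne_zero k)] at h
  have h2 : ∑ x ∈ antidiagonal (k + 1), expTerm B x.1 * expTerm (-B) x.2
      = (((k + 1).factorial : ℝ)⁻¹) •
        ∑ m ∈ antidiagonal (k + 1), (k + 1).choose m.1 • (B ^ m.1 * (-B) ^ m.2) := by
    rw [smul_sum]
    refine sum_congr rfl fun x hx => ?_
    have hx' := mem_antidiagonal.1 hx
    rw [expTerm, expTerm, smul_mul_smul_comm, ← Nat.cast_smul_eq_nsmul ℝ, smul_smul]
    congr 1
    have hc := Nat.choose_mul_factorial_mul_factorial (Nat.le_add_right x.1 x.2)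
    rw [Nat.add_sub_cancel_left, hx'] at hc
    rw [← hc]
    have h0 : (((k + 1).choose x.1 : ℕ) : ℝ) ≠ 0 := by
      exact_mod_cast (Nat.choose_pos (by omega)).ne'
    push_cast
    field_simp
  rw [h2, ← h, smul_zero]

end Ring

variable {R : Type*} [Ring R]

/-- Congruence of polynomials modulo `X ^ m`. -/
def Cong (m : ℕ) (P Q : R[X]) : Prop := ∀ d < m, P.coeff d = Q.coeff d

namespace Cong

variable {m : ℕ} {P Q P' Q' S : R[X]}

lemma refl (m : ℕ) (P : R[X]) : Cong m P P := fun _ _ => rfl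

lemma symm (h : Cong m P Q) : Cong m Q P := fun d hd => (h d hd).symm

lemma trans (h : Cong m P Q) (h' : Cong m Q S) : Cong m P S :=
  fun d hd => (h d hd).trans (h' d hd)

lemma mono {m' : ℕ} (h : Cong m P Q) (hm : m' ≤ m) : Cong m' P Q :=
  fun d hd => h d (hd.trans_le hm)

lemma mul (h : Cong m P Q) (h' : Cong m P' Q') : Cong m (P * P') (Q * Q') := fun d hd => by
  rw [coeff_mul, coeff_mul]
  refine sum_congr rfl fun x hx => ?_
  have hx := mem_antidiagonal.1 hx
  rw [h _ (by omega), h' _ (by omega)]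

lemma mul_left (S : R[X]) (h : Cong m P Q) : Cong m (S * P) (S * Q) := (refl m S).mul h

lemma mul_right (S : R[X]) (h : Cong m P Q) : Cong m (P * S) (Q * S) := h.mul (refl m S)

end Cong

lemma coeff_mul_eq_zero {P Q : R[X]} {i j d : ℕ} (hP : ∀ k < i, P.coeff k = 0)
    (hQ : ∀ k < j, Q.coeff k = 0) (hd : d < i + j) : (P * Q).coeff d = 0 := by
  rw [coeff_mul]
  refine sum_eq_zero fun x hx => ?_
  have hx := mem_antidiagonal.1 hx
  by_cases h : x.1 < i
  · rw [hP _ h, zero_mul]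
  · rw [hQ _ (by omega), mul_zero]

lemma coeff_pow_eq_zero {B : R[X]} (hB : B.coeff 0 = 0) (k d : ℕ) (hd : d < k) :
    (B ^ k).coeff d = 0 := by
  induction k generalizing d with
  | zero => omega
  | succ k ih =>
    rw [pow_succ]
    exact coeff_mul_eq_zero (j := 1) ih (fun k hk => by rw [Nat.lt_one_iff.1 hk, hB]) hd

lemma coeff_adPow_eq_zero {B : R[X]} (hB : B.coeff 0 = 0) (Y : R[X]) (k d : ℕ) (hd : d < k) :
    (adPow B Y k).coeff d = 0 := by
  have hB' : ∀ k < 1, B.coeff k = 0 := fun k hk => by rw [Nat.lt_one_iff.1 hk, hB]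
  induction k generalizing d with
  | zero => omega
  | succ k ih =>
    rw [adPow, Ring.lie_def, coeff_sub, coeff_mul_eq_zero hB' ih (by omega),
      coeff_mul_eq_zero ih hB' hd, sub_zero]

lemma coeff_neg_zero {B : R[X]} (hB : B.coeff 0 = 0) : (-B).coeff 0 = 0 := by simp [hB]

/-- If `f j l` is divisible by `X ^ (j + l)`, triangular and square partial sums of the double
series agree modulo `X ^ m`. -/
lemma cong_sum_antidiagonal {f : ℕ → ℕ → R[X]} (hf : ∀ j l d, d < j + l → (f j l).coeff d = 0)
    {m n : ℕ} (hmn : m ≤ n) :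
    Cong m (∑ k ∈ range m, ∑ x ∈ antidiagonal k, f x.1 x.2)
      (∑ j ∈ range n, ∑ l ∈ range n, f j l) := by
  intro d hd
  simp only [finsetSum_coeff]
  rw [← sum_product' (range n) (range n) fun j l => (f j l).coeff d,
    ← sum_filter_of_ne (p := fun x : ℕ × ℕ => x.1 + x.2 < m),
    ← sum_fiberwise_of_maps_to (s := {x ∈ range n ×ˢ range n | x.1 + x.2 < m}) (t := range m)
      (g := fun x => x.1 + x.2)]
  · refine sum_congr rfl fun k hk => sum_congr ?_ fun _ _ => rfl
    have := mem_range.1 hk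
    ext x
    simp only [HasAntidiagonal.mem_antidiagonal, mem_filter, mem_product, mem_range]
    omega
  · intro x hx
    exact mem_range.2 (mem_filter.1 hx).2
  · intro x _ hx
    by_contra h
    exact hx (hf _ _ _ (by omega))

variable [Algebra ℝ R]

lemma derivative_expTerm (B : R[X]) (k : ℕ) :
    derivative (expTerm B (k + 1)) = ∑ x ∈ antidiagonal k,
      ((((x.1 + 1).factorial : ℝ)⁻¹) • adPow B (derivative B) x.1) * expTerm B x.2 := by
  have hd : ∀ (r : ℝ) (P : R[X]), derivative (r • P) = r • derivative P := fun r P => by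
    simp
  induction k with
  | zero => simp [adPow, expTerm]
  | succ k ih =>
    have h : (((k + 1 : ℕ) : ℝ) + 1) ≠ 0 := by positivity
    have hF : ∀ (i : ℕ) (F : R[X]), ((i : ℝ) + 1) • F + F = ((i : ℝ) + 1 + 1) • F := fun i F => by
      rw [add_smul ((i : ℝ) + 1) (1 : ℝ), one_smul]
    refine smul_right_injective R[X] h ?_
    beta_reduce
    rw [← hd, ← mul_expTerm, derivative_mul, ih, mul_sum]
    push_cast
    rw [add_smul, one_smul, ← sum_antidiagonal_weighted
        (fun j l => ((((j + 1).factorial : ℝ)⁻¹) • adPow B (derivative B) j) * expTerm B l)]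
    conv_rhs => rw [Finset.Nat.sum_antidiagonal_succ]
    rw [add_left_comm, ← sum_add_distrib]
    congr 1
    · simp [adPow]
    refine sum_congr rfl fun x _ => ?_
    have hj : ((x.1 : ℝ) + 1 + 1) ≠ 0 := by positivity
    rw [← mul_smul_comm ((x.2 : ℝ) + 1), ← mul_expTerm, add_assoc, hF x.1,
      ← smul_mul_assoc ((x.1 : ℝ) + 1 + 1), smul_smul,
      Nat.factorial_succ (x.1 + 1), adPow, Ring.lie_def]
    push_cast
    rw [mul_inv, mul_inv_cancel_left₀ hj]
    simp only [smul_mul_assoc, mul_smul_comm, sub_mul, mul_assoc, smul_sub]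
    abel

lemma coeff_expTerm_eq_zero {B : R[X]} (hB : B.coeff 0 = 0) (k d : ℕ) (hd : d < k) :
    (expTerm B k).coeff d = 0 := by
  rw [expTerm, coeff_smul, coeff_pow_eq_zero hB k d hd, smul_zero]

/-- `exp B * Y = (exp ad_B) Y * exp B`, modulo `X ^ (N + 1)`. -/
lemma expTrunc_mul_cong {B : R[X]} (hB : B.coeff 0 = 0) (N : ℕ) (Y : R[X]) :
    Cong (N + 1) (expTrunc N B * Y) (conjTrunc N B Y * expTrunc N B) := by
  rw [expTrunc, conjTrunc, sum_mul, sum_mul_sum]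
  simp_rw [expTerm_mul]
  refine cong_sum_antidiagonal
    (f := fun j l => (((j.factorial : ℝ)⁻¹) • adPow B Y j) * expTerm B l)
    (fun j l d hd => ?_) le_rfl
  refine coeff_mul_eq_zero (fun k hk => ?_) (coeff_expTerm_eq_zero hB l) hd
  rw [coeff_smul, coeff_adPow_eq_zero hB Y j k hk, smul_zero]

/-- `(exp B)' = ((exp ad_B - 1) / ad_B) B' * exp B`, modulo `X ^ N`. -/
lemma derivative_expTrunc_cong {B : R[X]} (hB : B.coeff 0 = 0) (N : ℕ) :
    Cong N (derivative (expTrunc N B)) (dexpTrunc N B (derivative B) * expTrunc N B) := by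
  rw [expTrunc, dexpTrunc, derivative_sum, sum_range_succ']
  simp_rw [derivative_expTerm]
  rw [expTerm_zero, derivative_one, add_zero, sum_mul_sum]
  refine cong_sum_antidiagonal
    (f := fun j l => ((((j + 1).factorial : ℝ)⁻¹) • adPow B (derivative B) j) * expTerm B l)
    (fun j l d hd => ?_) (Nat.le_succ N)
  refine coeff_mul_eq_zero (fun k hk => ?_) (coeff_expTerm_eq_zero hB l) hd
  rw [coeff_smul, coeff_adPow_eq_zero hB _ j k hk, smul_zero]

lemma expTrunc_mul_expTrunc_neg {B : R[X]} (hB : B.coeff 0 = 0) (N : ℕ) :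
    Cong (N + 1) (expTrunc N B * expTrunc N (-B)) 1 := by
  have h : (1 : R[X]) = ∑ k ∈ range (N + 1), ∑ x ∈ antidiagonal k,
      expTerm B x.1 * expTerm (-B) x.2 := by
    rw [sum_range_succ']
    simp_rw [sum_expTerm_mul_expTerm_neg]
    simp
  rw [h, expTrunc, expTrunc, sum_mul_sum]
  exact (cong_sum_antidiagonal (f := fun j l => expTerm B j * expTerm (-B) l)
    (fun j l d hd => coeff_mul_eq_zero (coeff_expTerm_eq_zero hB j)
      (coeff_expTerm_eq_zero (coeff_neg_zero hB) l) hd) le_rfl).symm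

/-- `Q` is the polynomial `P(-X)`. -/
def IsReflection (P Q : R[X]) : Prop := ∀ d, Q.coeff d = (-1 : ℝ) ^ d • P.coeff d

namespace IsReflection

variable {P Q P' Q' : R[X]}

lemma one : IsReflection (1 : R[X]) 1 := fun d => by
  rw [coeff_one]
  rcases eq_or_ne d 0 with rfl | h
  · simp
  · simp [h]

lemma mul (h : IsReflection P Q) (h' : IsReflection P' Q') : IsReflection (P * P') (Q * Q') :=
    fun d => by
  rw [coeff_mul, coeff_mul, smul_sum]
  refine sum_congr rfl fun x hx => ?_
  rw [h, h', smul_mul_smul_comm, ← pow_add, mem_antidiagonal.1 hx]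

lemma pow (h : IsReflection P Q) (k : ℕ) : IsReflection (P ^ k) (Q ^ k) := by
  induction k with
  | zero => simpa using one
  | succ k ih => rw [pow_succ, pow_succ]; exact ih.mul h

lemma expTrunc (h : IsReflection P Q) (N : ℕ) : IsReflection (expTrunc N P) (expTrunc N Q) :=
    fun d => by
  simp only [ModifiedSplitting.expTrunc, expTerm, finsetSum_coeff, coeff_smul, smul_sum]
  refine sum_congr rfl fun k _ => ?_
  rw [h.pow k d, smul_comm]

end IsReflection

lemma isReflection_neg_of_odd {B : R[X]} (hB : ∀ d, Even d → B.coeff d = 0) :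
    IsReflection B (-B) := fun d => by
  rcases Nat.even_or_odd d with h | h
  · simp [hB d h]
  · simp [h.neg_one_pow]

/-- The series `X ↦ exp (X H)`, as far as its coefficients below `m` are concerned. -/
def IsExpUpTo (H : R) (E : R[X]) (m : ℕ) : Prop :=
  ∀ d < m, E.coeff d = ((d.factorial : ℝ)⁻¹) • H ^ d

lemma sum_exp_coeff_alternating (H : R) (d : ℕ) :
    ∑ x ∈ antidiagonal (d + 1), (((x.1.factorial : ℝ)⁻¹) • H ^ x.1) *
      ((-1 : ℝ) ^ x.2 • ((x.2.factorial : ℝ)⁻¹) • H ^ x.2) = 0 := by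
  rw [← sum_expTerm_mul_expTerm_neg H d]
  refine sum_congr rfl fun x _ => ?_
  rw [expTerm, expTerm, smul_comm]
  congr 2
  rcases Nat.even_or_odd x.2 with h | h
  · simp [h.neg_one_pow, h.neg_pow]
  · simp [h.neg_one_pow, h.neg_pow]

/-- A time-symmetric series which agrees with `exp (X H)` up to an odd power agrees with it one
power further. -/
lemma IsExpUpTo.succ_of_symm {H : R} {E E' : R[X]} {d m : ℕ} (h : IsExpUpTo H E (d + 1))
    (hE' : IsReflection E E') (hinv : Cong m (E * E') 1) (hd : Odd d) (hm : d + 1 < m) :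
    IsExpUpTo H E (d + 2) := by
  intro k hk
  rcases (Nat.lt_succ_iff.1 hk).lt_or_eq with hk | rfl
  · exact h k hk
  obtain ⟨n, rfl⟩ := hd
  have hev : Even (2 * n + 2) := ⟨n + 1, by ring⟩
  have h1 : ∑ x ∈ antidiagonal (2 * n + 2), E.coeff x.1 * E'.coeff x.2 = 0 := by
    rw [← coeff_mul, hinv _ hm, coeff_one, if_neg (Nat.succ_ne_zero _)]
  have h2 : ∑ x ∈ antidiagonal (2 * n + 2), (((x.1.factorial : ℝ)⁻¹) • H ^ x.1) *
      ((-1 : ℝ) ^ x.2 • ((x.2.factorial : ℝ)⁻¹) • H ^ x.2) = 0 :=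
    sum_exp_coeff_alternating H (2 * n + 1)
  have hE0 : E.coeff 0 = 1 := by simpa using h 0 (by omega)
  have hE0' : E'.coeff 0 = 1 := by rw [hE', hE0]; simp
  have h3 : ∑ x ∈ antidiagonal (2 * n), E.coeff (x.1 + 1) * E'.coeff (x.2 + 1)
      = ∑ x ∈ antidiagonal (2 * n), ((((x.1 + 1).factorial : ℝ)⁻¹) • H ^ (x.1 + 1)) *
      ((-1 : ℝ) ^ (x.2 + 1) • (((x.2 + 1).factorial : ℝ)⁻¹) • H ^ (x.2 + 1)) :=
    sum_congr rfl fun x hx => by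
      have := mem_antidiagonal.1 hx
      rw [hE', h _ (by omega), h _ (by omega)]
  rw [Finset.Nat.antidiagonal_succ_succ', sum_cons, sum_cons, sum_map] at h1 h2
  -- only the two outermost terms involve the unknown coefficient
  simp only [Function.Embedding.prodMap, Function.Embedding.coeFn_mk, Prod.map, Nat.succ_eq_add_one,
    hE0, hE0', one_mul, mul_one, pow_zero, Nat.factorial_zero, Nat.cast_one, inv_one, one_smul,
    hE' (2 * n + 2), hev.neg_one_pow, h3] at h1 h2
  have h4 : (2 : ℝ) • E.coeff (2 * n + 2)
      = (2 : ℝ) • ((((2 * n + 2).factorial : ℝ)⁻¹) • H ^ (2 * n + 2)) := by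
    rw [two_smul, two_smul, ← sub_eq_zero, ← sub_eq_zero.2 (h1.trans h2.symm)]
    abel
  exact smul_right_injective R two_ne_zero h4

/-- The symmetric product `exp W * exp B * exp W` of truncated exponentials. -/
def symmProd (N : ℕ) (W B : R[X]) : R[X] := expTrunc N W * expTrunc N B * expTrunc N W

lemma symmProd_mul_symmProd_neg {W B : R[X]} (hW : W.coeff 0 = 0) (hB : B.coeff 0 = 0) (N : ℕ) :
    Cong (N + 1) (symmProd N W B * symmProd N (-W) (-B)) 1 := by
  have e1 : symmProd N W B * symmProd N (-W) (-B) = expTrunc N W * expTrunc N B *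
      (expTrunc N W * expTrunc N (-W)) * (expTrunc N (-B) * expTrunc N (-W)) := by
    simp only [symmProd, mul_assoc]
  have e2 : expTrunc N W * expTrunc N B * 1 * (expTrunc N (-B) * expTrunc N (-W)) =
      expTrunc N W * (expTrunc N B * expTrunc N (-B)) * expTrunc N (-W) := by
    simp only [mul_assoc, one_mul]
  rw [e1]
  refine (((expTrunc_mul_expTrunc_neg hW N).mul_left _).mul_right _).trans ?_
  rw [e2]
  refine (((expTrunc_mul_expTrunc_neg hB N).mul_left _).mul_right _).trans ?_
  rw [mul_one]
  exact expTrunc_mul_expTrunc_neg hW N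

/-- The defect, conjugated by `exp W`, between the logarithmic derivative of
`exp W * exp B * exp W` and the constant `H`, for a `W` with `[W, W'] = 0` and `ad_W ^ 3 H = 0`. -/
def defect (N : ℕ) (W B : R[X]) (H : R) : R[X] :=
  dexpTrunc N B (derivative B) + conjTrunc N B (derivative W)
    - (C H - derivative W - ⁅W, C H⁆ + (1 / 2 : ℝ) • ⁅W, ⁅W, C H⁆⁆)

lemma adPow_eq_zero_of_le {A : Type*} [Ring A] {B Y : A} {k : ℕ} (h : adPow B Y k = 0) {j : ℕ}
    (hj : k ≤ j) : adPow B Y j = 0 := by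
  induction j, hj using Nat.le_induction with
  | base => exact h
  | succ j _ ih => rw [adPow, ih, commutator_zero]

section Symmetric

variable {N : ℕ} {W B : R[X]} {H : R}

lemma derivative_expTrunc_of_commute (hW : W.coeff 0 = 0) (hWW : ⁅W, derivative W⁆ = 0) :
    Cong N (derivative (expTrunc N W)) (derivative W * expTrunc N W) := by
  have h : dexpTrunc N W (derivative W) = derivative W := by
    rw [dexpTrunc, sum_range_succ', sum_eq_zero]
    · simp [adPow]
    · intro j _
      rw [adPow_eq_zero_of_le (k := 1) hWW (by omega), smul_zero]
  simpa only [h] using derivative_expTrunc_cong hW N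

/-- Conjugation by `exp W` of the terms subtracted in `defect` gives `H - W'`. -/
lemma expTrunc_mul_kick (hN : 2 ≤ N) (hW : W.coeff 0 = 0) (hWW : ⁅W, derivative W⁆ = 0)
    (hWH : ⁅W, ⁅W, ⁅W, C H⁆⁆⁆ = 0) :
    Cong (N + 1) (expTrunc N W *
        (C H - derivative W - ⁅W, C H⁆ + (1 / 2 : ℝ) • ⁅W, ⁅W, C H⁆⁆))
      ((C H - derivative W) * expTrunc N W) := by
  set G := C H - derivative W - ⁅W, C H⁆ + (1 / 2 : ℝ) • ⁅W, ⁅W, C H⁆⁆ with hG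
  have h1 : ⁅W, G⁆ = ⁅W, C H⁆ - ⁅W, ⁅W, C H⁆⁆ := by
    rw [hG, commutator_add, commutator_sub, commutator_sub, commutator_smul, hWW, hWH]
    simp
  have h2 : ⁅W, ⁅W, G⁆⁆ = ⁅W, ⁅W, C H⁆⁆ := by
    rw [h1, commutator_sub, hWH, sub_zero]
  have h3 : adPow W G 3 = 0 := by simp [adPow, h2, hWH]
  have h : conjTrunc N W G = C H - derivative W := by
    obtain ⟨n, rfl⟩ := Nat.exists_eq_add_of_le hN
    rw [conjTrunc, show 2 + n + 1 = n + 3 by ring, sum_range_succ', sum_range_succ',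
      sum_range_succ', sum_eq_zero]
    · have h4 : adPow W G (0 + 1 + 1) = ⁅W, ⁅W, C H⁆⁆ := h2
      have h5 : adPow W G (0 + 1) = ⁅W, C H⁆ - ⁅W, ⁅W, C H⁆⁆ := h1
      rw [h4, h5, adPow, hG]
      norm_num
      module
    · intro j _
      rw [adPow_eq_zero_of_le h3 (by omega), smul_zero]
  simpa only [h] using expTrunc_mul_cong hW N G

/-- `E = exp W * exp B * exp W` solves `E' = H E`, up to the conjugated defect. -/
lemma derivative_symmProd (hN : 2 ≤ N) (hW : W.coeff 0 = 0) (hB : B.coeff 0 = 0)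
    (hWW : ⁅W, derivative W⁆ = 0) (hWH : ⁅W, ⁅W, ⁅W, C H⁆⁆⁆ = 0) :
    Cong N (derivative (symmProd N W B))
      (C H * symmProd N W B +
        expTrunc N W * defect N W B H * (expTrunc N B * expTrunc N W)) := by
  have e1 : derivative (symmProd N W B) =
      derivative (expTrunc N W) * (expTrunc N B * expTrunc N W)
        + expTrunc N W * derivative (expTrunc N B) * expTrunc N W
        + expTrunc N W * expTrunc N B * derivative (expTrunc N W) := by
    rw [symmProd, derivative_mul, derivative_mul]
    simp only [add_mul, mul_assoc]
  have c1 := (derivative_expTrunc_of_commute (N := N) hW hWW).mul_right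
    (expTrunc N B * expTrunc N W)
  have c2 := ((derivative_expTrunc_cong hB N).mul_left (expTrunc N W)).mul_right (expTrunc N W)
  have c3 := (derivative_expTrunc_of_commute (N := N) hW hWW).mul_left
    (expTrunc N W * expTrunc N B)
  have c4 := (((expTrunc_mul_cong hB N (derivative W)).mono (Nat.le_succ N)).mul_left
    (expTrunc N W)).mul_right (expTrunc N W)
  have c5 := ((expTrunc_mul_kick hN hW hWW hWH).mono (Nat.le_succ N)).mul_right
    (expTrunc N B * expTrunc N W)
  rw [e1]
  intro d hd
  have c1 := c1 d hd
  have c2 := c2 d hd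
  have c3 := c3 d hd
  have c4 := c4 d hd
  have c5 := c5 d hd
  simp only [defect, symmProd, mul_sub, sub_mul, mul_add, add_mul, coeff_add, coeff_sub, mul_assoc]
    at c1 c2 c3 c4 c5 ⊢
  rw [c1, c2, c3, c4]
  rw [← sub_eq_zero] at c5 ⊢
  refine Eq.trans ?_ c5
  abel

/-- If the even coefficients of the defect vanish, then `exp W * exp B * exp W` agrees with
`exp (X H)` through order `N`.  The odd coefficients need no check: the product is time-symmetric,
and a symmetric method has even order. -/
theorem isExpUpTo_symmProd (hN : 2 ≤ N)
    (hW : ∀ d, Even d → W.coeff d = 0) (hB : ∀ d, Even d → B.coeff d = 0)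
    (hWW : ⁅W, derivative W⁆ = 0) (hWH : ⁅W, ⁅W, ⁅W, C H⁆⁆⁆ = 0)
    (hZ : ∀ d < N, Even d → (defect N W B H).coeff d = 0) :
    IsExpUpTo H (symmProd N W B) (N + 1) := by
  have hW0 := hW 0 Even.zero
  have hB0 := hB 0 Even.zero
  have key := derivative_symmProd hN hW0 hB0 hWW hWH
  have hc0 : ∀ P : R[X], P.coeff 0 = 0 → (expTrunc N P).coeff 0 = 1 := fun P hP => by
    rw [expTrunc, finsetSum_coeff, sum_range_succ', sum_eq_zero, expTerm_zero]
    · simp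
    · intro k _
      exact coeff_expTerm_eq_zero hP _ _ (Nat.succ_pos k)
  have hE0 : (symmProd N W B).coeff 0 = 1 := by
    simp [symmProd, mul_coeff_zero, hc0 W hW0, hc0 B hB0]
  -- the coefficient of `X ^ d` in the differential equation, when the defect vanishes below `d`
  have step : ∀ d < N, IsExpUpTo H (symmProd N W B) (d + 1) →
      (∀ k < d, (defect N W B H).coeff k = 0) →
      ((d : ℝ) + 1) • (symmProd N W B).coeff (d + 1) =
        ((d.factorial : ℝ)⁻¹) • H ^ (d + 1) + (defect N W B H).coeff d := by
    intro d hd hE hlow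
    have h := key d hd
    have hmid : (expTrunc N W * defect N W B H * (expTrunc N B * expTrunc N W)).coeff d
        = (defect N W B H).coeff d := by
      have hl : ∀ k ≤ d, (expTrunc N W * defect N W B H).coeff k = (defect N W B H).coeff k := by
        intro k hk
        rw [coeff_mul, sum_eq_single (0, k)]
        · simp [hc0 W hW0]
        · rintro ⟨i, j⟩ hx hne
          have := mem_antidiagonal.1 hx
          simp only at this
          rw [hlow j, mul_zero]
          by_contra hj
          exact hne (by ext <;> simp only <;> omega)
        · intro h; exact absurd (HasAntidiagonal.mem_antidiagonal.2 (by simp)) h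
      rw [coeff_mul, sum_eq_single (d, 0)]
      · simp [mul_coeff_zero, hc0 W hW0, hc0 B hB0, hl d le_rfl]
      · rintro ⟨i, j⟩ hx hne
        have := mem_antidiagonal.1 hx
        simp only at this
        rw [hl i (by omega), hlow i, zero_mul]
        by_contra hj
        exact hne (by ext <;> simp only <;> omega)
      · intro h; exact absurd (HasAntidiagonal.mem_antidiagonal.2 (by simp)) h
    rw [coeff_derivative, coeff_add, coeff_C_mul, hmid, hE d (Nat.lt_succ_self d),
      mul_smul_comm, ← pow_succ'] at h
    rw [← h, ← Nat.cast_add_one, ← Nat.cast_add_one, Nat.cast_smul_eq_nsmul, nsmul_eq_mul,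
      Nat.cast_comm]
  have main : ∀ d ≤ N, IsExpUpTo H (symmProd N W B) (d + 1) ∧
      ∀ k < d, (defect N W B H).coeff k = 0 := by
    intro d
    induction d with
    | zero =>
      refine fun _ => ⟨fun k hk => ?_, fun k hk => absurd hk (Nat.not_lt_zero k)⟩
      rw [Nat.lt_one_iff.1 hk, hE0]
      simp
    | succ d ih =>
      intro hd
      obtain ⟨ih1, ih2⟩ := ih (by omega)
      have hs := step d (by omega) ih1 ih2
      have hne : ((d : ℝ) + 1) ≠ 0 := by positivity
      have hfac : ((d : ℝ) + 1) • ((((d + 1).factorial : ℝ)⁻¹) • H ^ (d + 1))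
          = ((d.factorial : ℝ)⁻¹) • H ^ (d + 1) := by
        rw [smul_smul, Nat.factorial_succ]
        push_cast
        rw [mul_inv, mul_inv_cancel_left₀ hne]
      have hor : IsExpUpTo H (symmProd N W B) (d + 1 + 1) ∧ (defect N W B H).coeff d = 0 := by
        rcases Nat.even_or_odd d with he | ho
        · have hz := hZ d (by omega) he
          refine ⟨fun k hk => ?_, hz⟩
          rcases (Nat.lt_succ_iff.1 hk).lt_or_eq with hk | rfl
          · exact ih1 k hk
          · rw [hz, add_zero, ← hfac] at hs
            exact smul_right_injective R hne hs
        · have hr : IsReflection (symmProd N W B) (symmProd N (-W) (-B)) :=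
            have hrW := (isReflection_neg_of_odd hW).expTrunc N
            (hrW.mul ((isReflection_neg_of_odd hB).expTrunc N)).mul hrW
          have h2 := ih1.succ_of_symm hr (symmProd_mul_symmProd_neg hW0 hB0 N) ho (by omega)
          refine ⟨h2, ?_⟩
          rw [h2 (d + 1) (by omega), hfac] at hs
          exact left_eq_add.1 hs
      refine ⟨hor.1, fun k hk => ?_⟩
      rcases (Nat.lt_succ_iff.1 hk).lt_or_eq with hk | rfl
      · exact ih2 k hk
      · exact hor.2
  exact (main N le_rfl).1

end Symmetric

end Formal

/-! ### The Poisson algebra of smooth functions on phase space -/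

section Poisson

open Finset

/-- The smooth functions on phase space, as a subalgebra of all functions. -/
def smoothSubalgebra (n : ℕ) : Subalgebra ℝ (Phase n → ℝ) where
  carrier := {f | ContDiff ℝ ∞ f}
  mul_mem' {f g} (hf : ContDiff ℝ ∞ f) (hg : ContDiff ℝ ∞ g) := hf.mul hg
  add_mem' {f g} (hf : ContDiff ℝ ∞ f) (hg : ContDiff ℝ ∞ g) := hf.add hg
  algebraMap_mem' r := (contDiff_const : ContDiff ℝ ∞ fun _ : Phase n => r)

/-- The algebra of smooth functions on phase space. -/
def Sm (n : ℕ) : Type := smoothSubalgebra n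

variable {n : ℕ}

namespace Sm

instance : CommRing (Sm n) := inferInstanceAs (CommRing (smoothSubalgebra n))

instance : Algebra ℝ (Sm n) := inferInstanceAs (Algebra ℝ (smoothSubalgebra n))

instance : FunLike (Sm n) (Phase n) ℝ where
  coe f := f.1
  coe_injective _ _ h := Subtype.ext h

/-- A smooth function as an element of `Sm n`. -/
def mk (f : Phase n → ℝ) (hf : ContDiff ℝ ∞ f) : Sm n :=
  (⟨f, hf⟩ : smoothSubalgebra n)

@[simp] lemma coe_mk (f : Phase n → ℝ) (hf : ContDiff ℝ ∞ f) : ⇑(mk f hf) = f := rfl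

@[ext] lemma ext {f g : Sm n} (h : ∀ z, f z = g z) : f = g := DFunLike.ext f g h

lemma contDiff (f : Sm n) : ContDiff ℝ ∞ (f : Phase n → ℝ) := f.2

lemma coe_add (f g : Sm n) : ⇑(f + g) = ⇑f + ⇑g := rfl
lemma coe_mul (f g : Sm n) : ⇑(f * g) = ⇑f * ⇑g := rfl
lemma coe_smul (r : ℝ) (f : Sm n) : ⇑(r • f) = r • ⇑f := rfl

@[simp] lemma add_apply (f g : Sm n) (z : Phase n) : (f + g) z = f z + g z := rfl
@[simp] lemma sub_apply (f g : Sm n) (z : Phase n) : (f - g) z = f z - g z := rfl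
@[simp] lemma neg_apply (f : Sm n) (z : Phase n) : (-f) z = -f z := rfl
@[simp] lemma mul_apply (f g : Sm n) (z : Phase n) : (f * g) z = f z * g z := rfl
@[simp] lemma smul_apply (r : ℝ) (f : Sm n) (z : Phase n) : (r • f) z = r * f z := rfl
@[simp] lemma zero_apply (z : Phase n) : (0 : Sm n) z = 0 := rfl

/-- Evaluation at a point of phase space. -/
def eval (z : Phase n) : Sm n →ₗ[ℝ] ℝ where
  toFun f := f z
  map_add' _ _ := rfl
  map_smul' _ _ := rfl

@[simp] lemma sum_apply {ι : Type*} (s : Finset ι) (f : ι → Sm n) (z : Phase n) :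
    (∑ i ∈ s, f i) z = ∑ i ∈ s, f i z := map_sum (eval z) f s

lemma differentiableAt (f : Sm n) (z : Phase n) : DifferentiableAt ℝ (f : Phase n → ℝ) z :=
  (contDiff f).differentiable (by simp) z

/-- The derivative in the constant direction `v`, as a derivation of the algebra `Sm n`. -/
def dir (v : Phase n) : Derivation ℝ (Sm n) (Sm n) :=
  Derivation.mk'
    { toFun := fun f => mk (fun z => fderiv ℝ f z v)
        (((contDiff f).fderiv_right (m := ∞) (by simp)).clm_apply contDiff_const)
      map_add' := fun f g => ext fun z => by
        simp [coe_add, fderiv_add (differentiableAt f z) (differentiableAt g z)]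
      map_smul' := fun r f => ext fun z => by
        simp [coe_smul, fderiv_const_smul (differentiableAt f z) r] }
    fun f g => ext fun z => by
      simp [coe_mul, fderiv_mul (differentiableAt f z) (differentiableAt g z)]

lemma dir_apply (v : Phase n) (f : Sm n) (z : Phase n) :
    (dir v f : Phase n → ℝ) z = fderiv ℝ f z v := rfl

lemma dir_comm (v w : Phase n) (f : Sm n) : dir v (dir w f) = dir w (dir v f) := by
  have key : ∀ v w : Phase n, ∀ z, (dir v (dir w f) : Phase n → ℝ) z
      = fderiv ℝ (fderiv ℝ f) z v w := fun v w z => by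
    have hd : DifferentiableAt ℝ (fderiv ℝ (f : Phase n → ℝ)) z :=
      ((contDiff f).fderiv_right (m := ∞) (by simp)).differentiable (by simp) z
    have : (dir w f : Phase n → ℝ) = fun y => fderiv ℝ f y w := rfl
    rw [dir_apply, this, fderiv_clm_apply hd (differentiableAt_const w)]
    simp
  refine ext fun z => ?_
  rw [key, key]
  exact ((contDiff f).contDiffAt.isSymmSndFDerivAt
    (by rw [minSmoothness_of_isRCLikeNormedField]; exact WithTop.coe_le_coe.2 le_top)) v w

/-- `∂/∂q^a` on smooth functions. -/
def dQ (a : Fin n) : Derivation ℝ (Sm n) (Sm n) := dir (Pi.single a 1, 0)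

/-- `∂/∂p_a` on smooth functions. -/
def dP (a : Fin n) : Derivation ℝ (Sm n) (Sm n) := dir (0, Pi.single a 1)

lemma coe_dQ (a : Fin n) (f : Sm n) : (dQ a f : Phase n → ℝ) = dq a f := rfl

lemma coe_dP (a : Fin n) (f : Sm n) : (dP a f : Phase n → ℝ) = dp a f := rfl

lemma dQ_dQ (a b : Fin n) (f : Sm n) : dQ a (dQ b f) = dQ b (dQ a f) := dir_comm _ _ _
lemma dP_dQ (a b : Fin n) (f : Sm n) : dP a (dQ b f) = dQ b (dP a f) := dir_comm _ _ _
lemma dP_dP (a b : Fin n) (f : Sm n) : dP a (dP b f) = dP b (dP a f) := dir_comm _ _ _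

/-- The bilinear map `P(f, g) = ∑ₐ ∂f/∂q^a ∂g/∂p_a`, half of the Poisson bracket. -/
def halfBr : Sm n →ₗ[ℝ] Sm n →ₗ[ℝ] Sm n :=
  LinearMap.mk₂ ℝ (fun f g => ∑ a, dQ a f * dP a g)
    (fun f f' g => by simp [add_mul, sum_add_distrib])
    (fun r f g => by simp [smul_sum])
    (fun f g g' => by simp [mul_add, sum_add_distrib])
    (fun r f g => by simp [smul_sum])

lemma halfBr_apply (f g : Sm n) : halfBr f g = ∑ a, dQ a f * dP a g := rfl

/-- `L f g = {g, f}`, the derivative of `g` along the Hamiltonian flow of `f`. -/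
def L : Sm n →ₗ[ℝ] Module.End ℝ (Sm n) :=
  LinearMap.mk₂ ℝ (fun f g => halfBr g f - halfBr f g)
    (fun f f' g => by rw [map_add, map_add, LinearMap.add_apply]; abel)
    (fun r f g => by rw [map_smul, map_smul, LinearMap.smul_apply, smul_sub])
    (fun f g g' => by rw [map_add, map_add, LinearMap.add_apply]; abel)
    (fun r f g => by rw [map_smul, map_smul, LinearMap.smul_apply, smul_sub])

lemma L_apply (f g : Sm n) : L f g = halfBr g f - halfBr f g := rfl

lemma L_self (f : Sm n) : L f f = 0 := sub_self _

/-- The Jacobi identity. -/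
lemma L_jacobi (f g h : Sm n) : L f (L g h) - L g (L f h) = L (L f g) h := by
  have hL : ∀ f g : Sm n, L f g = ∑ a, (dQ a g * dP a f - dQ a f * dP a g) := fun f g => by
    rw [L_apply, halfBr_apply, halfBr_apply, sum_sub_distrib]
  rw [← sub_eq_zero]
  rw [hL (L f g) h, hL f (L g h), hL g (L f h)]
  simp only [hL, map_sum, map_sub, Derivation.leibniz, smul_eq_mul, sum_mul, mul_sum,
    ← sum_sub_distrib]
  set X : Fin n → Fin n → Sm n := fun a b => _ with hX
  change ∑ a, ∑ b, X a b = 0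
  have h2 : (2 : ℝ) • ∑ a, ∑ b, X a b = 0 := by
    rw [two_smul]
    nth_rewrite 2 [sum_comm]
    rw [← sum_add_distrib]
    refine sum_eq_zero fun a _ => ?_
    rw [← sum_add_distrib]
    refine sum_eq_zero fun b _ => ?_
    simp only [hX, dP_dQ, dQ_dQ b a, dP_dP b a]
    ring
  exact (smul_eq_zero.1 h2).resolve_left two_ne_zero

lemma L_lie (f g : Sm n) : ⁅L f, L g⁆ = L (L f g) :=
  LinearMap.ext fun h => L_jacobi f g h

/-! ### The tensor calculus of kinetic and potential energies -/

/-- The momentum `p_a`. -/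
def mom (a : Fin n) : Sm n := mk (fun z => z.2 a) (by fun_prop)

lemma dir_mom (v : Phase n) (a : Fin n) : dir v (mom a) = algebraMap ℝ (Sm n) (v.2 a) := by
  refine ext fun z => ?_
  have h : (mom a : Phase n → ℝ) =
      (ContinuousLinearMap.proj (R := ℝ) (φ := fun _ : Fin n => ℝ) a).comp
        (ContinuousLinearMap.snd ℝ (Fin n → ℝ) (Fin n → ℝ)) := rfl
  rw [dir_apply, h, ContinuousLinearMap.fderiv]
  rfl

lemma dQ_mom (a b : Fin n) : dQ a (mom b) = 0 := by simp [dQ, dir_mom]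

lemma dP_mom (a b : Fin n) : dP a (mom b) = if a = b then 1 else 0 := by
  rw [dP, dir_mom]
  rcases eq_or_ne a b with rfl | h
  · simp
  · simp [h, h.symm]

/-- A function of the positions only. -/
def IsPot (f : Sm n) : Prop := ∀ a, dP a f = 0

lemma IsPot.smul {f : Sm n} (hf : IsPot f) (r : ℝ) : IsPot (r • f) := fun a => by
  rw [Derivation.map_smul, hf a, smul_zero]

lemma IsPot.add {f g : Sm n} (hf : IsPot f) (hg : IsPot g) : IsPot (f + g) := fun a => by
  rw [map_add, hf a, hg a, add_zero]

lemma IsPot.zero : IsPot (0 : Sm n) := fun _ => map_zero _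

lemma IsPot.sum {ι : Type*} {s : Finset ι} {f : ι → Sm n} (hf : ∀ i ∈ s, IsPot (f i)) :
    IsPot (∑ i ∈ s, f i) := fun a => by
  rw [map_sum]
  exact sum_eq_zero fun i hi => hf i hi a

lemma IsPot.halfBr {g : Sm n} (hg : IsPot g) (f : Sm n) : halfBr f g = 0 := by
  simp [halfBr_apply, hg _]

lemma IsPot.L_eq_zero {f g : Sm n} (hf : IsPot f) (hg : IsPot g) : L f g = 0 := by
  rw [L_apply, hf.halfBr, hg.halfBr, sub_zero]

section Metric

variable (M : Matrix (Fin n) (Fin n) ℝ)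

/-- `∂^a = M^{ab} ∂_b` on smooth functions. -/
def dUp (a : Fin n) : Derivation ℝ (Sm n) (Sm n) := ∑ b, M a b • dQ b

lemma dUp_apply (a : Fin n) (f : Sm n) : dUp M a f = ∑ b, M a b • dQ b f := by
  simp only [dUp, ← Derivation.coeFnAddMonoidHom_apply, map_sum, Finset.sum_apply]
  rfl

lemma coe_dUp (a : Fin n) (f : Sm n) : (dUp M a f : Phase n → ℝ) = dqUp M a f := by
  rw [dUp_apply]
  funext z
  simp [dqUp, coe_dQ]

/-- `D = p_a ∂^a` on smooth functions. -/
def opD : Derivation ℝ (Sm n) (Sm n) := ∑ a, mom a • dUp M a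

lemma opD_apply (f : Sm n) : opD M f = ∑ a, mom a * dUp M a f := by
  simp only [opD, ← Derivation.coeFnAddMonoidHom_apply, map_sum, Finset.sum_apply]
  rfl

lemma coe_opD (f : Sm n) : (opD M f : Phase n → ℝ) = D M f := by
  rw [opD_apply]
  funext z
  simp [D, ← coe_dUp, mom]

/-- The gradient product `Γ(f, g) = ∑ₐ ∂_a f ∂^a g`. -/
def grad : Sm n →ₗ[ℝ] Sm n →ₗ[ℝ] Sm n :=
  LinearMap.mk₂ ℝ (fun f g => ∑ a, dQ a f * dUp M a g)
    (fun f f' g => by simp [add_mul, sum_add_distrib])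
    (fun r f g => by simp [smul_sum])
    (fun f g g' => by simp [mul_add, sum_add_distrib])
    (fun r f g => by simp [smul_sum])

lemma grad_apply (f g : Sm n) : grad M f g = ∑ a, dQ a f * dUp M a g := rfl

lemma coe_grad (U f : Sm n) : (grad M U f : Phase n → ℝ) = Dbar M U f := by
  rw [grad_apply]
  funext z
  simp [Dbar, ← coe_dUp, coe_dQ]

/-- The Hessian of `f` on the gradients of `g` and `h`:
`Λ(f; g, h) = ∑ ∂^a ∂^b f ∂_a g ∂_b h`. -/
def hess (f g h : Sm n) : Sm n := ∑ a, ∑ b, dUp M a (dUp M b f) * (dQ a g * dQ b h)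

/-- `∑ ∂^a ∂^b ∂^c f ∂_a g ∂_b g ∂_c g`. -/
def third (f g : Sm n) : Sm n :=
  ∑ a, ∑ b, ∑ c, dQ a g * dQ b g * dQ c g * dUp M a (dUp M b (dUp M c f))

lemma coe_third (U f : Sm n) : (third M f U : Phase n → ℝ) = Dbar3 M U f := by
  funext z
  simp [third, Dbar3, ← coe_dUp, coe_dQ]

lemma dQ_dUp (a b : Fin n) (f : Sm n) : dQ a (dUp M b f) = dUp M b (dQ a f) := by
  simp [dUp_apply, dQ_dQ a]

lemma dP_dUp (a b : Fin n) (f : Sm n) : dP a (dUp M b f) = dUp M b (dP a f) := by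
  simp [dUp_apply, dP_dQ a]

lemma dUp_dUp (a b : Fin n) (f : Sm n) : dUp M a (dUp M b f) = dUp M b (dUp M a f) := by
  simp only [dUp_apply M a, dQ_dUp, map_sum, Derivation.map_smul]

lemma dUp_mom (a b : Fin n) : dUp M a (mom b) = 0 := by
  simp [dUp_apply, dQ_mom]

lemma dQ_opD (a : Fin n) (f : Sm n) : dQ a (opD M f) = opD M (dQ a f) := by
  simp [opD_apply, dQ_dUp, dQ_mom]

lemma dUp_opD (a : Fin n) (f : Sm n) : dUp M a (opD M f) = opD M (dUp M a f) := by
  simp [opD_apply, dUp_dUp M a, dUp_mom]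

lemma dP_opD (a : Fin n) (f : Sm n) : dP a (opD M f) = dUp M a f + opD M (dP a f) := by
  simp [opD_apply, dP_dUp, dP_mom, sum_add_distrib, add_comm]

lemma hess_comm (f g h : Sm n) : hess M f g h = hess M f h g := by
  rw [hess, sum_comm]
  refine sum_congr rfl fun a _ => sum_congr rfl fun b _ => ?_
  rw [dUp_dUp]
  ring

lemma opD_grad (f g : Sm n) :
    opD M (grad M f g) = grad M (opD M f) g + grad M f (opD M g) := by
  simp only [grad_apply, map_sum, Derivation.leibniz, smul_eq_mul, dQ_opD, dUp_opD]
  rw [← sum_add_distrib]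
  exact sum_congr rfl fun a _ => by ring

lemma opD_hess (f g h : Sm n) : opD M (hess M f g h) =
    hess M (opD M f) g h + hess M f (opD M g) h + hess M f g (opD M h) := by
  simp only [hess, map_sum, Derivation.leibniz, smul_eq_mul, dQ_opD, dUp_opD]
  simp only [← sum_add_distrib]
  exact sum_congr rfl fun a _ => sum_congr rfl fun b _ => by ring

lemma IsPot.grad {f g : Sm n} (hf : IsPot f) (hg : IsPot g) : IsPot (grad M f g) := fun a => by
  simp [grad_apply, dP_dQ, dP_dUp, hf a, hg a]

lemma IsPot.third {f g : Sm n} (hf : IsPot f) (hg : IsPot g) :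
    IsPot (third M f g) := fun a => by
  simp [Sm.third, dP_dQ, dP_dUp, hf a, hg a]

lemma IsPot.L_opD {f g : Sm n} (hf : IsPot f) (hg : IsPot g) :
    L f (opD M g) = -Sm.grad M f g := by
  rw [L_apply, hf.halfBr, zero_sub, halfBr_apply, grad_apply]
  simp only [dP_opD, hg _, map_zero, add_zero]

/-- The kinetic energy. -/
def kinS : Sm n :=
  (1 / 2 : ℝ) • ∑ a, mom a * ∑ b, M a b • mom b

lemma coe_kinS : (kinS M : Phase n → ℝ) = kin M := by
  funext z
  simp [kinS, kin, mom, dotProduct, Matrix.mulVec]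

lemma dQ_kinS (a : Fin n) : dQ a (kinS M) = 0 := by
  simp [kinS, dQ_mom]

variable {M} (hM : M.IsSymm)
include hM

lemma sum_dQ_mul_dUp (F G : Sm n) : ∑ a, dQ a F * dUp M a G = ∑ a, dUp M a F * dQ a G := by
  simp only [dUp_apply, mul_sum, sum_mul]
  rw [sum_comm]
  refine sum_congr rfl fun a _ => sum_congr rfl fun b _ => ?_
  rw [hM.apply a b]
  simp

lemma grad_comm (f g : Sm n) : grad M f g = grad M g f := by
  rw [grad_apply, grad_apply, sum_dQ_mul_dUp hM]
  exact sum_congr rfl fun a _ => mul_comm _ _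

lemma hess_eq (f g h : Sm n) : hess M f g h = ∑ a, dQ a g * grad M (dUp M a f) h := by
  rw [hess]
  refine sum_congr rfl fun a _ => ?_
  rw [grad_apply, sum_dQ_mul_dUp hM, mul_sum]
  refine sum_congr rfl fun b _ => ?_
  rw [dUp_dUp]
  ring

lemma grad_grad (f g h : Sm n) :
    grad M (grad M f g) h = hess M f g h + hess M g f h := by
  have e : ∀ f g : Sm n, hess M f g h = ∑ a, ∑ b, dQ b g * dQ a (dUp M b f) * dUp M a h := by
    intro f g
    rw [hess_eq hM, sum_comm]
    refine sum_congr rfl fun b _ => ?_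
    rw [grad_apply, mul_sum]
    exact sum_congr rfl fun a _ => by ring
  rw [e, e, ← sum_add_distrib]
  rw [grad_comm hM f g]
  rw [grad_apply M (grad M g f), grad_apply M g f]
  simp only [map_sum, Derivation.leibniz, smul_eq_mul]
  refine sum_congr rfl fun a _ => ?_
  have h1 : ∑ b, dUp M b f * dQ a (dQ b g) = ∑ b, dQ b f * dQ a (dUp M b g) := by
    simp only [dQ_dQ a, dQ_dUp, sum_dQ_mul_dUp hM]
  simp only [← sum_mul, sum_add_distrib, add_mul, h1]

/-- `p`-derivatives of a gradient product, contracted with `f`, for factors whose `p`-derivatives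
are gradients. -/
lemma halfBr_grad (f : Sm n) {g g' h h' : Sm n} {c c' : ℝ} (hg : ∀ a, dP a g = c • dUp M a g')
    (hh : ∀ a, dP a h = c' • dUp M a h') :
    halfBr f (grad M g h) = c • hess M g' f h + c' • hess M h' f g := by
  rw [hess_eq hM, hess_eq hM, halfBr_apply, smul_sum, smul_sum, ← sum_add_distrib]
  refine sum_congr rfl fun a _ => ?_
  have h1 : dP a (grad M g h) = grad M (dP a g) h + grad M g (dP a h) := by
    simp only [grad_apply, map_sum, Derivation.leibniz, smul_eq_mul, dP_dQ, dP_dUp,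
      ← sum_add_distrib]
    exact sum_congr rfl fun b _ => by ring
  rw [h1, hg, hh, map_smul, map_smul, LinearMap.smul_apply, grad_comm hM g, mul_add,
    mul_smul_comm, mul_smul_comm]

lemma dQ_grad (a : Fin n) (f : Sm n) : dQ a (grad M f f) = (2 : ℝ) • grad M f (dQ a f) := by
  have h : dQ a (grad M f f) = grad M (dQ a f) f + grad M f (dQ a f) := by
    simp only [grad_apply, map_sum, Derivation.leibniz, smul_eq_mul, dQ_dQ a, dQ_dUp,
      ← sum_add_distrib]
    exact sum_congr rfl fun b _ => by ring
  rw [h, grad_comm hM _ f, two_smul]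

lemma dUp_grad (a : Fin n) (f : Sm n) : dUp M a (grad M f f) = (2 : ℝ) • grad M (dUp M a f) f := by
  have h : dUp M a (grad M f f) = grad M (dUp M a f) f + grad M f (dUp M a f) := by
    simp only [grad_apply, map_sum, Derivation.leibniz, smul_eq_mul, dUp_dUp M a, dQ_dUp,
      ← sum_add_distrib]
    exact sum_congr rfl fun b _ => by ring
  rw [h, grad_comm hM f, two_smul]

/-- The derivative of `Λ(U; U, U)` along the gradient of `U`. -/
lemma grad_hess_self (U : Sm n) : grad M U (hess M U U U) =
    third M U U + (1 / 2 : ℝ) • grad M (grad M U U) (grad M U U) := by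
  have e : ∀ f, grad M U f = ∑ c, dUp M c U * dQ c f := fun f => by
    rw [grad_apply, sum_dQ_mul_dUp hM]
  have e_mul : ∀ f g, grad M U (f * g) = grad M U f * g + f * grad M U g := fun f g => by
    simp only [e, Derivation.leibniz, smul_eq_mul, sum_mul, mul_sum, ← sum_add_distrib]
    exact sum_congr rfl fun c _ => by ring
  have h1 : ∑ a, grad M U (dQ a U) * grad M (dUp M a U) U =
      (1 / 4 : ℝ) • grad M (grad M U U) (grad M U U) := by
    rw [grad_apply M (grad M U U), smul_sum]
    refine sum_congr rfl fun a _ => ?_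
    rw [dQ_grad hM, dUp_grad hM, smul_mul_smul_comm, smul_smul]
    norm_num
  have h2 : ∑ a, dQ a U * hess M (dUp M a U) U U = third M U U := by
    simp only [hess, third, mul_sum]
    refine sum_congr rfl fun a _ => sum_congr rfl fun b _ => sum_congr rfl fun c _ => ?_
    rw [dUp_dUp M c a, dUp_dUp M b a]
    ring
  have h3 : ∑ a, dQ a U * hess M U (dUp M a U) U =
      ∑ a, grad M U (dQ a U) * grad M (dUp M a U) U := by
    simp only [hess_eq hM U, mul_sum]
    rw [sum_comm]
    refine sum_congr rfl fun c _ => ?_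
    rw [grad_apply M U, sum_mul]
    refine sum_congr rfl fun a _ => ?_
    rw [dQ_dUp]
    ring
  have h4 : grad M U (hess M U U U) = ∑ a, grad M U (dQ a U) * grad M (dUp M a U) U +
      (∑ a, dQ a U * hess M (dUp M a U) U U + ∑ a, dQ a U * hess M U (dUp M a U) U) := by
    rw [hess_eq hM, map_sum]
    simp only [e_mul, sum_add_distrib, grad_comm hM U (grad M _ _), grad_grad hM, mul_add]
  rw [h4, h3, h2, h1]
  module

lemma dP_kinS (a : Fin n) : dP a (kinS M) = ∑ b, M a b • mom b := by
  have h : ∑ x, mom x * (M x a • (1 : Sm n)) = ∑ b, M a b • mom b :=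
    sum_congr rfl fun b _ => by rw [hM.apply a b]; simp
  simp only [kinS, Derivation.map_smul, map_sum, Derivation.leibniz, dP_mom, smul_eq_mul,
    sum_add_distrib, smul_ite, smul_zero, mul_ite, mul_zero, mul_one, sum_ite_eq, mem_univ,
    if_true]
  change (1 / 2 : ℝ) • (∑ x, mom x * (M x a • (1 : Sm n)) + _) = _
  rw [h, ← two_smul ℝ, smul_smul]
  norm_num

/-- The Poisson bracket with the kinetic energy is `D`. -/
lemma L_kinS (f : Sm n) : L (kinS M) f = opD M f := by
  rw [L_apply, halfBr_apply, halfBr_apply, opD_apply]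
  simp only [dQ_kinS, dP_kinS hM, zero_mul, sum_const_zero, sub_zero, dUp_apply, mul_sum]
  rw [sum_comm]
  refine sum_congr rfl fun a _ => sum_congr rfl fun b _ => ?_
  rw [hM.apply a b]
  simp [mul_comm]

end Metric

end Sm
end Poisson

/-! ### Coefficients of the defect as functions on phase space -/

section Coefficients

open Polynomial Finset

variable {n : ℕ}

/-- The coefficients of the operator polynomial `P` are the Poisson derivations of the functions
`b i`. -/
def Rep (P : (Module.End ℝ (Sm n))[X]) (b : ℕ → Sm n) : Prop := ∀ i, P.coeff i = Sm.L (b i)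

/-- The Cauchy product of two sequences of functions with respect to `(f, g) ↦ L f g`. -/
def brSeq (b c : ℕ → Sm n) : ℕ → Sm n := fun d => ∑ x ∈ antidiagonal d, Sm.L (b x.1) (c x.2)

/-- The iterated products `brSeq b (brSeq b ⋯ c)`. -/
def brIter (b c : ℕ → Sm n) : ℕ → ℕ → Sm n
  | 0 => c
  | j + 1 => brSeq b (brIter b c j)

/-- The sequence of coefficients of the derivative. -/
def derivSeq (b : ℕ → Sm n) : ℕ → Sm n := fun i => ((i : ℝ) + 1) • b (i + 1)

/-- The sequence of coefficients of a constant. -/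
def constSeq (h : Sm n) : ℕ → Sm n := fun i => if i = 0 then h else 0

namespace Rep

variable {P Q : (Module.End ℝ (Sm n))[X]} {b c : ℕ → Sm n}

lemma lie (hP : Rep P b) (hQ : Rep Q c) : Rep ⁅P, Q⁆ (brSeq b c) := fun d => by
  rw [Ring.lie_def, coeff_sub, coeff_mul, coeff_mul, brSeq, map_sum,
    ← Finset.Nat.sum_antidiagonal_swap (f := fun x => Q.coeff x.1 * P.coeff x.2),
    ← sum_sub_distrib]
  refine sum_congr rfl fun x _ => ?_
  rw [← Sm.L_lie, hP, Prod.fst_swap, Prod.snd_swap, hP, hQ, Ring.lie_def]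

lemma adPow (hP : Rep P b) (hQ : Rep Q c) (j : ℕ) : Rep (adPow P Q j) (brIter b c j) := by
  induction j with
  | zero => exact hQ
  | succ j ih => exact hP.lie ih

lemma derivative (hP : Rep P b) : Rep (derivative P) (derivSeq b) := fun i => by
  rw [coeff_derivative, hP, derivSeq, map_smul, ← Nat.cast_add_one, ← Nat.cast_add_one,
    Nat.cast_smul_eq_nsmul, nsmul_eq_mul, Nat.cast_comm]

lemma const (h : Sm n) : Rep (C (Sm.L h)) (constSeq h) := fun i => by
  rw [coeff_C, constSeq]
  split_ifs
  · rfl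
  · rw [map_zero]

end Rep

lemma brIter_eq_zero {b c : ℕ → Sm n} (hb : b 0 = 0) {j d : ℕ} (hd : d < j) :
    brIter b c j d = 0 := by
  induction j generalizing d with
  | zero => omega
  | succ j ih =>
    rw [brIter, brSeq]
    refine sum_eq_zero fun x hx => ?_
    have hx := mem_antidiagonal.1 hx
    rcases Nat.eq_zero_or_pos x.1 with h | h
    · rw [h, hb, map_zero, LinearMap.zero_apply]
    · rw [ih (by omega), map_zero]

/-- The function whose Poisson derivation is the coefficient of `X ^ d` in `defect`. -/
def defectSeq (w b : ℕ → Sm n) (h : Sm n) (d : ℕ) : Sm n :=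
  ∑ j ∈ range (d + 1), ((((j + 1).factorial : ℝ)⁻¹) • brIter b (derivSeq b) j d
      + ((j.factorial : ℝ)⁻¹) • brIter b (derivSeq w) j d)
    - (constSeq h d - derivSeq w d - brSeq w (constSeq h) d
      + (1 / 2 : ℝ) • brSeq w (brSeq w (constSeq h)) d)

lemma coeff_defect {N d : ℕ} (hd : d ≤ N) {W B : (Module.End ℝ (Sm n))[X]} {w b : ℕ → Sm n}
    (hW : Rep W w) (hB : Rep B b) (h : Sm n) (hb : b 0 = 0) :
    (defect N W B (Sm.L h)).coeff d = Sm.L (defectSeq w b h d) := by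
  have hsum : ∀ f : ℕ → Sm n, (∀ j, d < j → f j = 0) →
      ∑ j ∈ range (N + 1), f j = ∑ j ∈ range (d + 1), f j := fun f hf => by
    symm
    refine sum_subset (range_subset_range.2 (by omega)) fun j _ hj => hf j ?_
    simpa using hj
  have hs : ∑ j ∈ range (d + 1), ((((j + 1).factorial : ℝ)⁻¹) • brIter b (derivSeq b) j d
      + ((j.factorial : ℝ)⁻¹) • brIter b (derivSeq w) j d) =
      ∑ j ∈ range (N + 1), (((j + 1).factorial : ℝ)⁻¹) • brIter b (derivSeq b) j d
      + ∑ j ∈ range (N + 1), ((j.factorial : ℝ)⁻¹) • brIter b (derivSeq w) j d := by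
    rw [← sum_add_distrib, hsum]
    intro j hj
    rw [brIter_eq_zero hb hj, brIter_eq_zero hb hj, smul_zero, smul_zero, add_zero]
  rw [defectSeq, hs, defect, dexpTrunc, conjTrunc]
  have e1 := (hW.lie (Rep.const h)) d
  have e2 := (hW.lie (hW.lie (Rep.const h))) d
  have e3 := Rep.const h d
  have e4 := hW.derivative d
  have e5 := fun j => hB.adPow hB.derivative j d
  have e6 := fun j => hB.adPow hW.derivative j d
  simp only [coeff_sub, coeff_add, coeff_smul, finsetSum_coeff, e1, e2, e3, e4, e5, e6, map_sub,
    map_add, map_sum, map_smul]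

section OddSeq

variable {b c : ℕ → Sm n} (hb : ∀ i, Even i → b i = 0)
include hb

lemma brSeq_of_odd_zero : brSeq b c 0 = 0 := by
  simp [brSeq, hb 0 (by decide)]

lemma brSeq_of_odd_one : brSeq b c 1 = Sm.L (b 1) (c 0) := by
  simp [brSeq, Finset.Nat.sum_antidiagonal_eq_sum_range_succ_mk, sum_range_succ, hb 0 (by decide)]

lemma brSeq_of_odd_two : brSeq b c 2 = Sm.L (b 1) (c 1) := by
  simp [brSeq, Finset.Nat.sum_antidiagonal_eq_sum_range_succ_mk, sum_range_succ, hb 0 (by decide),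
    hb 2 (by decide)]

lemma brSeq_of_odd_three : brSeq b c 3 = Sm.L (b 1) (c 2) + Sm.L (b 3) (c 0) := by
  simp [brSeq, Finset.Nat.sum_antidiagonal_eq_sum_range_succ_mk, sum_range_succ, hb 0 (by decide),
    hb 2 (by decide)]

lemma brSeq_of_odd_four : brSeq b c 4 = Sm.L (b 1) (c 3) + Sm.L (b 3) (c 1) := by
  simp [brSeq, Finset.Nat.sum_antidiagonal_eq_sum_range_succ_mk, sum_range_succ, hb 0 (by decide),
    hb 2 (by decide), hb 4 (by decide)]

lemma brSeq_of_odd_five :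
    brSeq b c 5 = Sm.L (b 1) (c 4) + Sm.L (b 3) (c 2) + Sm.L (b 5) (c 0) := by
  simp [brSeq, Finset.Nat.sum_antidiagonal_eq_sum_range_succ_mk, sum_range_succ, hb 0 (by decide),
    hb 2 (by decide), hb 4 (by decide)]

lemma brSeq_of_odd_six :
    brSeq b c 6 = Sm.L (b 1) (c 5) + Sm.L (b 3) (c 3) + Sm.L (b 5) (c 1) := by
  simp [brSeq, Finset.Nat.sum_antidiagonal_eq_sum_range_succ_mk, sum_range_succ, hb 0 (by decide),
    hb 2 (by decide), hb 4 (by decide), hb 6 (by decide)]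

end OddSeq

end Coefficients

section Corrections

open Finset Sm

variable {n : ℕ} (M : Matrix (Fin n) (Fin n) ℝ) (V : Sm n)

/-- The iterated derivative `D ^ i V` of the potential. -/
def Dpow (i : ℕ) : Sm n := (opD M)^[i] V

/-- The kinetic energy `T`, for `k = 0`, and its corrections `T_{2k}` as smooth functions. -/
def tS : ℕ → Sm n
  | 0 => kinS M
  | 1 => -(1 / 12 : ℝ) • opD M (opD M V)
  | 2 => (1 / 720 : ℝ) • (opD M (opD M (opD M (opD M V)))
      - (9 : ℝ) • grad M V (opD M (opD M V)) + (3 : ℝ) • opD M (grad M V (opD M V)))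
  | 3 => -(1 / 60480 : ℝ) • (
      (2 : ℝ) • opD M (opD M (opD M (opD M (opD M (opD M V)))))
      - (40 : ℝ) • grad M V (opD M (opD M (opD M (opD M V))))
      + (46 : ℝ) • opD M (grad M V (opD M (opD M (opD M V))))
      - (15 : ℝ) • opD M (opD M (grad M V (opD M (opD M V))))
      + (54 : ℝ) • grad M V (grad M V (opD M (opD M V)))
      - (9 : ℝ) • grad M V (opD M (grad M V (opD M V)))
      - (42 : ℝ) • opD M (grad M V (grad M V (opD M V)))
      + (12 : ℝ) • opD M (opD M (grad M V (grad M V V))))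
  | _ => 0

/-- The potential `V`, for `k = 0`, and its corrections `V_{2k}` as smooth functions. -/
def vS : ℕ → Sm n
  | 0 => V
  | 1 => (1 / 24 : ℝ) • grad M V V
  | 2 => (1 / 480 : ℝ) • grad M V (grad M V V)
  | 3 => (1 / 161280 : ℝ) •
      ((17 : ℝ) • grad M V (grad M V (grad M V V)) - (10 : ℝ) • third M V V)
  | _ => 0

variable {V}

lemma coe_tS {V₀ : (Fin n → ℝ) → ℝ} (hV : (V : Phase n → ℝ) = pot V₀) (k : ℕ) (hk : 1 ≤ k) :
    (tS M V k : Phase n → ℝ) = Tcorr M V₀ k := by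
  match k, hk with
  | 1, _ => funext z; simp [tS, Tcorr, T2, coe_opD, hV]
  | 2, _ => funext z; simp [tS, Tcorr, T4, coe_opD, coe_grad, hV, mul_add]
  | 3, _ => funext z; simp [tS, Tcorr, T6, coe_opD, coe_grad, hV, mul_add]
  | k + 4, _ => rfl

lemma coe_vS {V₀ : (Fin n → ℝ) → ℝ} (hV : (V : Phase n → ℝ) = pot V₀) (k : ℕ) (hk : 1 ≤ k) :
    (vS M V k : Phase n → ℝ) = Vcorr M V₀ k := by
  match k, hk with
  | 1, _ => funext z; simp [vS, Vcorr, V2, coe_grad, hV]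
  | 2, _ => funext z; simp [vS, Vcorr, V4, coe_grad, hV]
  | 3, _ => funext z; simp [vS, Vcorr, V6, coe_grad, coe_third, hV]
  | k + 4, _ => rfl

end Corrections

/-! ### The corrections in terms of iterated derivatives of the potential -/

section Identities

open Finset Sm

variable {n : ℕ} {M : Matrix (Fin n) (Fin n) ℝ} {V : Sm n}

lemma opD_Dpow (i : ℕ) : opD M (Dpow M V i) = Dpow M V (i + 1) :=
  (Function.iterate_succ_apply' _ _ _).symm

lemma dP_Dpow (hV : IsPot V) (i : ℕ) (a : Fin n) :
    dP a (Dpow M V i) = (i : ℝ) • dUp M a (Dpow M V (i - 1)) := by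
  induction i with
  | zero => simpa [Dpow] using hV a
  | succ i ih =>
    rw [← opD_Dpow, dP_opD, ih, Derivation.map_smul, ← dUp_opD, opD_Dpow]
    rcases i with _ | i
    · simp
    · simp only [Nat.add_sub_cancel]
      push_cast
      module

lemma halfBr_Dpow (hV : IsPot V) (f : Sm n) (i : ℕ) :
    halfBr f (Dpow M V i) = (i : ℝ) • grad M f (Dpow M V (i - 1)) := by
  rw [halfBr_apply, grad_apply, smul_sum]
  exact sum_congr rfl fun a _ => by rw [dP_Dpow hV, mul_smul_comm]

lemma L_Dpow_Dpow (hV : IsPot V) (i j : ℕ) : L (Dpow M V i) (Dpow M V j) =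
    (i : ℝ) • grad M (Dpow M V j) (Dpow M V (i - 1))
      - (j : ℝ) • grad M (Dpow M V i) (Dpow M V (j - 1)) := by
  rw [L_apply, halfBr_Dpow hV, halfBr_Dpow hV]

lemma L_grad_Dpow (i j k : ℕ) : L (grad M (Dpow M V j) (Dpow M V k)) (Dpow M V i) =
    -L (Dpow M V i) (grad M (Dpow M V j) (Dpow M V k)) := by
  rw [L_apply, L_apply, neg_sub]

lemma L_swap_kinS (f : Sm n) : L f (kinS M) = -L (kinS M) f := by
  rw [L_apply, L_apply, neg_sub]

lemma tS_zero : tS M V 0 = kinS M := rfl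

lemma tS_one : tS M V 1 = -(1 / 12 : ℝ) • Dpow M V 2 := rfl

/-- In products of derivatives `D ^ i V`, the fourth-order correction. -/
lemma tS_two : tS M V 2 = (1 / 720 : ℝ) • (Dpow M V 4
    - (6 : ℝ) • grad M (Dpow M V 0) (Dpow M V 2)
    + (3 : ℝ) • grad M (Dpow M V 1) (Dpow M V 1)) := by
  have h : V = Dpow M V 0 := rfl
  rw [tS]
  conv_lhs => rw [h]
  simp only [opD_Dpow, opD_grad, zero_add, Nat.reduceAdd]
  module

lemma vS_zero : vS M V 0 = Dpow M V 0 := rfl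

lemma vS_one : vS M V 1 = (1 / 24 : ℝ) • grad M (Dpow M V 0) (Dpow M V 0) := rfl

lemma isPot_vS (hV : IsPot V) (k : ℕ) : IsPot (vS M V k) := by
  have hg := hV.grad M hV
  match k with
  | 0 => exact hV
  | 1 => exact hg.smul _
  | 2 => exact (hV.grad M hg).smul _
  | 3 =>
    rw [vS, sub_eq_add_neg, ← neg_smul]
    exact (((hV.grad M (hV.grad M hg)).smul _).add ((hV.third M hV).smul _)).smul _
  | k + 4 => exact IsPot.zero

lemma brSeq_isPot {w c : ℕ → Sm n} (hw : ∀ i, IsPot (w i)) (hc : ∀ i, IsPot (c i)) :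
    brSeq w c = 0 := by
  funext d
  exact sum_eq_zero fun x _ => (hw _).L_eq_zero (hc _)

section Symmetric

variable (hM : M.IsSymm)
include hM

lemma grad_grad' (f g h : Sm n) :
    grad M f (grad M g h) = hess M g h f + hess M h g f := by
  rw [grad_comm hM, grad_grad hM]

lemma opD_kinS : opD M (kinS M) = 0 := by
  rw [← L_kinS hM, L_self]

lemma tS_three : tS M V 3 = -(1 / 60480 : ℝ) • ((2 : ℝ) • Dpow M V 6
    - (9 : ℝ) • grad M (Dpow M V 0) (Dpow M V 4)
    + (16 : ℝ) • grad M (Dpow M V 1) (Dpow M V 3)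
    - (15 : ℝ) • grad M (Dpow M V 2) (Dpow M V 2)
    + (27 : ℝ) • hess M (Dpow M V 2) (Dpow M V 0) (Dpow M V 0)
    - (48 : ℝ) • hess M (Dpow M V 1) (Dpow M V 0) (Dpow M V 1)
    + (6 : ℝ) • hess M (Dpow M V 0) (Dpow M V 1) (Dpow M V 1)
    + (51 : ℝ) • hess M (Dpow M V 0) (Dpow M V 0) (Dpow M V 2)) := by
  have h : V = Dpow M V 0 := rfl
  rw [tS]
  conv_lhs => rw [h]
  simp only [opD_Dpow, opD_grad, opD_hess, grad_grad' hM, map_add, zero_add, Nat.reduceAdd,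
    hess_comm M _ (Dpow M V 1) (Dpow M V 0), hess_comm M _ (Dpow M V 2) (Dpow M V 0)]
  module

lemma vS_two : vS M V 2 =
    (1 / 240 : ℝ) • hess M (Dpow M V 0) (Dpow M V 0) (Dpow M V 0) := by
  change (1 / 480 : ℝ) • grad M V (grad M V V) = (1 / 240 : ℝ) • hess M V V V
  rw [grad_grad' hM]
  module

/-- The correction is written with the terms `Γ(V, Λ(V; V, V))` and `Γ(Γ(V, V), Γ(V, V))` that occur
in the order condition, so that no third derivatives appear in it. -/
lemma vS_three : vS M V 3 = (1 / 23040 : ℝ) •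
    (((24 / 7 : ℝ) • grad M (Dpow M V 0) (hess M (Dpow M V 0) (Dpow M V 0) (Dpow M V 0)))
      + (10 / 7 : ℝ) • ((1 / 2 : ℝ) • grad M (grad M (Dpow M V 0) (Dpow M V 0))
        (grad M (Dpow M V 0) (Dpow M V 0)))) := by
  change (1 / 161280 : ℝ) •
      ((17 : ℝ) • grad M V (grad M V (grad M V V)) - (10 : ℝ) • third M V V) =
    (1 / 23040 : ℝ) • (((24 / 7 : ℝ) • grad M V (hess M V V V))
      + (10 / 7 : ℝ) • ((1 / 2 : ℝ) • grad M (grad M V V) (grad M V V)))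
  have h : third M V V = grad M V (hess M V V V)
      - (1 / 2 : ℝ) • grad M (grad M V V) (grad M V V) := by
    rw [grad_hess_self hM]
    abel
  have e : grad M V (grad M V V) = (2 : ℝ) • hess M V V V := by
    rw [grad_grad' hM, two_smul]
  rw [h, e, map_smul]
  module

variable (hV : IsPot V)
include hV

lemma L_Dpow_grad (i j k : ℕ) : L (Dpow M V i) (grad M (Dpow M V j) (Dpow M V k)) =
    (i : ℝ) • (hess M (Dpow M V j) (Dpow M V k) (Dpow M V (i - 1))
        + hess M (Dpow M V k) (Dpow M V j) (Dpow M V (i - 1)))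
      - ((j : ℝ) • hess M (Dpow M V (j - 1)) (Dpow M V i) (Dpow M V k)
        + (k : ℝ) • hess M (Dpow M V (k - 1)) (Dpow M V i) (Dpow M V j)) := by
  rw [L_apply, halfBr_Dpow hV, halfBr_grad hM _ (dP_Dpow hV j) (dP_Dpow hV k), grad_grad hM]

section Kick

variable {w : ℕ → Sm n} (hwp : ∀ i, IsPot (w i))
include hwp

lemma brSeq_constSeq : brSeq w (constSeq (kinS M + V)) = fun d => -opD M (w d) := by
  funext d
  rw [brSeq, sum_eq_single (d, 0)]
  · rw [constSeq, if_pos rfl, map_add, (hwp d).L_eq_zero hV, L_swap_kinS, L_kinS hM, add_zero]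
  · rintro ⟨i, j⟩ hx hne
    have hx := mem_antidiagonal.1 hx
    rw [constSeq, if_neg, map_zero]
    rintro rfl
    exact hne (by simpa using hx)
  · intro h
    exact absurd (HasAntidiagonal.mem_antidiagonal.2 (by simp)) h

lemma brSeq_brSeq_constSeq : brSeq w (brSeq w (constSeq (kinS M + V))) =
    fun d => ∑ x ∈ antidiagonal d, grad M (w x.1) (w x.2) := by
  funext d
  rw [brSeq_constSeq hM hV hwp, brSeq]
  exact sum_congr rfl fun x _ => by rw [map_neg, (hwp _).L_opD M (hwp _), neg_neg]

/-- The kick part of the defect is polynomial: two commutators with the kinetic energy turn a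
potential into a gradient product. -/
lemma defectSeq_eq (b : ℕ → Sm n) (d : ℕ) : defectSeq w b (kinS M + V) d =
    ∑ j ∈ range (d + 1), ((((j + 1).factorial : ℝ)⁻¹) • brIter b (derivSeq b) j d
      + ((j.factorial : ℝ)⁻¹) • brIter b (derivSeq w) j d)
    - (constSeq (kinS M + V) d - derivSeq w d + opD M (w d)
      + (1 / 2 : ℝ) • ∑ x ∈ antidiagonal d, grad M (w x.1) (w x.2)) := by
  rw [defectSeq, brSeq_brSeq_constSeq hM hV hwp, brSeq_constSeq hM hV hwp, sub_neg_eq_add]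

end Kick

section Order

variable {w b : ℕ → Sm n} (hwp : ∀ i, IsPot (w i))
  (hb : ∀ i, Even i → b i = 0) (hw : ∀ i, Even i → w i = 0)
  (hb1 : b 1 = tS M V 0) (hw1 : w 1 = (1 / 2 : ℝ) • vS M V 0)
include hM hV hwp hw hb1 hw1

/-- The order conditions are identities between linear combinations of the functions `D ^ i V`,
`Γ(D ^ i V, D ^ j V)`, `Λ(D ^ i V; D ^ j V, D ^ k V)` and the two terms of degree four in `V`. -/
lemma defectSeq_zero : defectSeq w b (kinS M + V) 0 = 0 := by
  rw [defectSeq_eq hM hV hwp]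
  simp [brIter, constSeq, derivSeq, hw 0 (by decide), hb1, hw1, tS_zero, vS]
  module

variable (hb3 : b 3 = tS M V 1) (hw3 : w 3 = (1 / 2 : ℝ) • vS M V 1)
include hb hb3 hw3

lemma defectSeq_two : defectSeq w b (kinS M + V) 2 = 0 := by
  rw [defectSeq_eq hM hV hwp]
  simp only [sum_range_succ, range_zero, sum_empty,
    Finset.Nat.sum_antidiagonal_eq_sum_range_succ_mk, Nat.reduceAdd, Nat.reduceSub, brIter,
    brSeq_of_odd_one hb, brSeq_of_odd_two hb, constSeq, derivSeq, OfNat.ofNat_ne_zero, if_false,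
    hb 2 (by decide), hw 0 (by decide), hw 2 (by decide), hb1, hw1, hb3, hw3,
    map_zero, smul_zero, add_zero, zero_add]
  norm_num [Nat.factorial]
  simp only [tS_zero, tS_one, vS_zero, vS_one, map_zero, neg_smul, L_kinS hM, opD_Dpow,
    opD_kinS hM, smul_zero, zero_add, Nat.reduceAdd]
  module

variable (hb5 : b 5 = tS M V 2) (hw5 : w 5 = (1 / 2 : ℝ) • vS M V 2)
include hb5 hw5

lemma defectSeq_four : defectSeq w b (kinS M + V) 4 = 0 := by
  rw [defectSeq_eq hM hV hwp]
  simp only [sum_range_succ, range_zero, sum_empty,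
    Finset.Nat.sum_antidiagonal_eq_sum_range_succ_mk, Nat.reduceAdd, Nat.reduceSub, brIter,
    brSeq_of_odd_zero hb, brSeq_of_odd_one hb, brSeq_of_odd_two hb, brSeq_of_odd_three hb,
    brSeq_of_odd_four hb, constSeq, derivSeq, OfNat.ofNat_ne_zero, if_false,
    hb 2 (by decide), hb 4 (by decide), hw 0 (by decide), hw 2 (by decide), hw 4 (by decide),
    hb1, hw1, hb3, hw3, hb5, hw5, map_zero, smul_zero, add_zero, zero_add]
  norm_num [Nat.factorial]
  simp only [tS_zero, tS_one, tS_two, vS_zero, vS_one, vS_two hM, map_zero, map_add, map_sub,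
    map_smul, map_neg, neg_smul, smul_neg, L_kinS hM, opD_Dpow, opD_kinS hM, opD_grad, L_swap_kinS,
    L_Dpow_Dpow hV, grad_grad' hM, grad_grad hM, Derivation.map_smul, LinearMap.smul_apply,
    LinearMap.neg_apply, smul_zero, add_zero, zero_add, Nat.reduceAdd, Nat.reduceSub]
  simp only [grad_comm hM (Dpow M V 2) (Dpow M V 0)]
  module

variable (hb7 : b 7 = tS M V 3) (hw7 : w 7 = (1 / 2 : ℝ) • vS M V 3)
include hb7 hw7

lemma defectSeq_six : defectSeq w b (kinS M + V) 6 = 0 := by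
  rw [defectSeq_eq hM hV hwp]
  simp only [sum_range_succ, range_zero, sum_empty,
    Finset.Nat.sum_antidiagonal_eq_sum_range_succ_mk, Nat.reduceAdd, Nat.reduceSub, brIter,
    brSeq_of_odd_zero hb, brSeq_of_odd_one hb, brSeq_of_odd_two hb, brSeq_of_odd_three hb,
    brSeq_of_odd_four hb, brSeq_of_odd_five hb, brSeq_of_odd_six hb,
    constSeq, derivSeq, OfNat.ofNat_ne_zero, if_false,
    hb 2 (by decide), hb 4 (by decide), hb 6 (by decide), hw 0 (by decide), hw 2 (by decide),
    hw 4 (by decide), hw 6 (by decide), hb1, hw1, hb3, hw3, hb5, hw5, hb7, hw7,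
    map_zero, smul_zero, add_zero, zero_add]
  norm_num [Nat.factorial]
  simp only [tS_zero, tS_one, tS_two, tS_three hM, vS_zero, vS_one, vS_two hM, vS_three hM,
    map_zero, map_add, map_sub, map_smul, map_neg, neg_smul, smul_neg, L_kinS hM, opD_Dpow,
    opD_kinS hM, opD_grad, opD_hess, L_swap_kinS, L_Dpow_Dpow hV, L_Dpow_grad hM hV, L_grad_Dpow,
    Derivation.map_smul, LinearMap.smul_apply, LinearMap.sub_apply, LinearMap.add_apply,
    LinearMap.neg_apply, smul_zero, add_zero, zero_add, Nat.reduceAdd, Nat.reduceSub]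
  simp only [grad_comm hM (Dpow M V 4) (Dpow M V 0), grad_comm hM (Dpow M V 3) (Dpow M V 1),
    grad_comm hM (hess M (Dpow M V 0) (Dpow M V 0) (Dpow M V 0)) (Dpow M V 0),
    hess_comm M _ (Dpow M V 1) (Dpow M V 0), hess_comm M _ (Dpow M V 2) (Dpow M V 0),
    hess_comm M _ (Dpow M V 2) (Dpow M V 1)]
  module

end Order

end Symmetric

end Identities

/-! ### The order conditions of the scheme -/

section Scheme

open Polynomial Finset Sm

variable {n : ℕ}

/-- The sequence with `f k` at the index `2 k + 1`, for `k ≤ K`, and `0` elsewhere. -/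
def oddSeq (K : ℕ) (f : ℕ → Sm n) (i : ℕ) : Sm n :=
  if i % 2 = 1 ∧ i / 2 ≤ K then f (i / 2) else 0

/-- The operator polynomial `∑_{k ≤ K} X ^ (2 k + 1) L (f k)`. -/
def oddPoly (K : ℕ) (f : ℕ → Sm n) : (Module.End ℝ (Sm n))[X] :=
  ∑ k ∈ range (K + 1), monomial (2 * k + 1) (L (f k))

lemma oddSeq_even (K : ℕ) (f : ℕ → Sm n) {i : ℕ} (hi : Even i) : oddSeq K f i = 0 :=
  if_neg fun h => by
    have := Nat.even_iff.1 hi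
    omega

lemma oddSeq_odd {K k : ℕ} (f : ℕ → Sm n) (hk : k ≤ K) : oddSeq K f (2 * k + 1) = f k := by
  rw [oddSeq, if_pos (by omega)]
  congr
  omega

lemma rep_oddPoly (K : ℕ) (f : ℕ → Sm n) : Rep (oddPoly K f) (oddSeq K f) := fun i => by
  simp only [oddPoly, finsetSum_coeff, coeff_monomial]
  rcases Nat.even_or_odd' i with ⟨k, rfl | rfl⟩
  · rw [oddSeq_even K f (even_two_mul k), map_zero]
    exact sum_eq_zero fun j _ => if_neg (by omega)
  · rcases le_or_gt k K with h | h
    · rw [oddSeq_odd f h, sum_eq_single k, if_pos rfl]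
      · intro j _ hj
        exact if_neg (by omega)
      · intro hk
        exact absurd (mem_range.2 (by omega)) hk
    · rw [oddSeq, if_neg (by omega), map_zero]
      refine sum_eq_zero fun j hj => if_neg ?_
      have := mem_range.1 hj
      omega

lemma coeff_zero_oddPoly (K : ℕ) (f : ℕ → Sm n) : (oddPoly K f).coeff 0 = 0 := by
  rw [rep_oddPoly, oddSeq_even _ _ Even.zero, map_zero]

lemma Rep.eq_zero {P : (Module.End ℝ (Sm n))[X]} (h : Rep P 0) : P = 0 := by
  ext1 i
  rw [h, Pi.zero_apply, map_zero, coeff_zero]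

variable (M : Matrix (Fin n) (Fin n) ℝ) (V : Sm n)

/-- The generator of half a kick, as a polynomial in the step length. -/
def kickPoly (K : ℕ) : (Module.End ℝ (Sm n))[X] := oddPoly K fun k => (1 / 2 : ℝ) • vS M V k

/-- The generator of a move, as a polynomial in the step length. -/
def movePoly (K : ℕ) : (Module.End ℝ (Sm n))[X] := oddPoly K (tS M V)

variable {M V}

/-- The order conditions: the operator of one step of the scheme agrees with the exponential
of the Poisson derivation of `H`. -/
lemma isExpUpTo_scheme (hM : M.IsSymm) (hV : IsPot V) {K N : ℕ}
    (hKN : (K = 1 ∧ N = 4) ∨ (K = 2 ∧ N = 6) ∨ (K = 3 ∧ N = 8)) :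
    IsExpUpTo (L (kinS M + V)) (symmProd N (kickPoly M V K) (movePoly M V K)) (N + 1) := by
  set w := oddSeq K fun k => (1 / 2 : ℝ) • vS M V k with hw
  set b := oddSeq K (tS M V) with hb
  have hW : Rep (kickPoly M V K) w := rep_oddPoly K _
  have hB : Rep (movePoly M V K) b := rep_oddPoly K _
  have hw0 : ∀ i, Even i → w i = 0 := fun i => oddSeq_even K _
  have hb0 : ∀ i, Even i → b i = 0 := fun i => oddSeq_even K _
  have hwp : ∀ i, IsPot (w i) := fun i => by
    rw [hw, oddSeq]
    split_ifs
    · exact (isPot_vS hV _).smul _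
    · exact IsPot.zero
  have hwk : ∀ k ≤ K, w (2 * k + 1) = (1 / 2 : ℝ) • vS M V k := fun k hk => oddSeq_odd _ hk
  have hbk : ∀ k ≤ K, b (2 * k + 1) = tS M V k := fun k hk => oddSeq_odd _ hk
  refine isExpUpTo_symmProd (by omega) (fun d hd => by rw [hW, hw0 d hd, map_zero])
    (fun d hd => by rw [hB, hb0 d hd, map_zero]) (Rep.eq_zero ?_) (Rep.eq_zero ?_)
    fun d hd hev => ?_
  · have h := hW.lie hW.derivative
    rwa [brSeq_isPot (c := derivSeq w) hwp fun i => (hwp _).smul _] at h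
  · have h := hW.lie (hW.lie (hW.lie (Rep.const (kinS M + V))))
    rwa [brSeq_brSeq_constSeq hM hV hwp,
      brSeq_isPot hwp fun i => IsPot.sum fun x _ => (hwp _).grad M (hwp _)] at h
  · rw [coeff_defect hd.le hW hB _ (hb0 0 (by decide))]
    suffices h : defectSeq w b (kinS M + V) d = 0 by rw [h, map_zero]
    have hcase : d = 0 ∨ d = 2 ∧ 1 ≤ K ∨ d = 4 ∧ 2 ≤ K ∨ d = 6 ∧ 3 ≤ K := by
      obtain ⟨e, rfl⟩ := hev
      omega
    have h0 := Nat.zero_le K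
    rcases hcase with rfl | ⟨rfl, hK⟩ | ⟨rfl, hK⟩ | ⟨rfl, hK⟩
    · exact defectSeq_zero hM hV hwp hw0 (hbk 0 h0) (hwk 0 h0)
    · exact defectSeq_two hM hV hwp hb0 hw0 (hbk 0 h0) (hwk 0 h0) (hbk 1 hK) (hwk 1 hK)
    · exact defectSeq_four hM hV hwp hb0 hw0 (hbk 0 h0) (hwk 0 h0) (hbk 1 (by omega))
        (hwk 1 (by omega)) (hbk 2 hK) (hwk 2 hK)
    · exact defectSeq_six hM hV hwp hb0 hw0 (hbk 0 h0) (hwk 0 h0) (hbk 1 (by omega))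
        (hwk 1 (by omega)) (hbk 2 (by omega)) (hwk 2 (by omega)) (hbk 3 hK) (hwk 3 hK)

end Scheme

/-! ### Autonomous differential equations on bounded sets -/

section ODE

open Set Metric
open scoped NNReal

variable {E : Type*} [NormedAddCommGroup E] [NormedSpace ℝ E]

/-- `γ` solves `γ' = X(γ)` on the time interval between `0` and `t`. -/
def Solves (X : E → E) (t : ℝ) (γ : ℝ → E) : Prop :=
  ∀ s ∈ uIcc 0 t, HasDerivWithinAt γ (X (γ s)) (uIcc 0 t) s

lemma Solves.continuousOn {X : E → E} {t : ℝ} {γ : ℝ → E} (h : Solves X t γ) :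
    ContinuousOn γ (uIcc 0 t) := fun s hs => (h s hs).continuousWithinAt

/-- The curves are confined to the ball on which the Picard iteration takes place. -/
lemma exists_solution_mem_closedBall [CompleteSpace E] {f : ℝ → E → E} {tmin tmax : ℝ}
    {t₀ : Icc tmin tmax} {x₀ x : E} {a r L K : ℝ≥0} (hf : IsPicardLindelof f t₀ x₀ a r L K)
    (hx : x ∈ closedBall x₀ r) :
    ∃ α : ℝ → E, α t₀ = x ∧ ∀ t ∈ Icc tmin tmax,
      HasDerivWithinAt α (f t (α t)) (Icc tmin tmax) t ∧ α t ∈ closedBall x₀ a := by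
  obtain ⟨α, hα⟩ := ODE.FunSpace.exists_isFixedPt_next hf hx
  refine ⟨α.compProj, by rw [ODE.FunSpace.compProj_val, ← hα, ODE.FunSpace.next_apply₀],
    fun t ht => ⟨?_, α.compProj_mem_closedBall hf.mul_max_le⟩⟩
  refine (ODE.hasDerivWithinAt_picard_Icc t₀.2 hf.continuousOn_uncurry
    α.continuous_compProj.continuousOn (fun _ _ => α.compProj_mem_closedBall hf.mul_max_le)
    x ht).congr_of_mem (fun t' ht' => ?_) ht
  nth_rw 1 [← hα]
  rw [ODE.FunSpace.compProj_of_mem ht', ODE.FunSpace.next_apply]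

variable [FiniteDimensional ℝ E]

lemma exists_lipschitzOnWith_closedBall {X : ℝ → E → E}
    (hX : ContDiff ℝ 1 fun p : ℝ × E => X p.1 p.2) (R : ℝ) :
    ∃ K : ℝ≥0, ∀ τ : ℝ, |τ| ≤ 1 → LipschitzOnWith K (X τ) (closedBall 0 R) := by
  obtain ⟨K, hK⟩ := hX.contDiffOn.exists_lipschitzOnWith one_ne_zero
    ((convex_closedBall (0 : ℝ) 1).prod (convex_closedBall (0 : E) R))
    ((isCompact_closedBall (0 : ℝ) 1).prod (isCompact_closedBall (0 : E) R))
  refine ⟨K, fun τ hτ => LipschitzOnWith.of_dist_le_mul fun x hx y hy => ?_⟩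
  have hτ' : τ ∈ closedBall (0 : ℝ) 1 := by simpa using hτ
  have h := hK.dist_le_mul (τ, x) ⟨hτ', hx⟩ (τ, y) ⟨hτ', hy⟩
  simpa [Prod.dist_eq] using h

lemma exists_norm_le_closedBall {X : ℝ → E → E}
    (hX : ContDiff ℝ 1 fun p : ℝ × E => X p.1 p.2) (R : ℝ) :
    ∃ L : ℝ≥0, ∀ τ : ℝ, |τ| ≤ 1 → ∀ x ∈ closedBall (0 : E) R, ‖X τ x‖ ≤ L := by
  obtain ⟨L, hL⟩ := ((isCompact_closedBall (0 : ℝ) 1).prod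
    (isCompact_closedBall (0 : E) R)).exists_bound_of_continuousOn hX.continuous.continuousOn
  exact ⟨L.toNNReal, fun τ hτ x hx =>
    (hL (τ, x) ⟨by simpa using hτ, hx⟩).trans (Real.le_coe_toNNReal L)⟩

lemma Solves.eqOn {X : E → E} (hX : ContDiff ℝ 1 X) {t : ℝ} {γ γ' : ℝ → E}
    (h : Solves X t γ) (h' : Solves X t γ') (h0 : γ 0 = γ' 0) : EqOn γ γ' (uIcc 0 t) := by
  obtain ⟨R, hR⟩ := ((isCompact_uIcc.image_of_continuousOn h.continuousOn).union
    (isCompact_uIcc.image_of_continuousOn h'.continuousOn)).isBounded.subset_closedBall 0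
  have hγ : ∀ s ∈ uIcc 0 t, γ s ∈ closedBall (0 : E) R := fun s hs =>
    hR (Or.inl (mem_image_of_mem _ hs))
  have hγ' : ∀ s ∈ uIcc 0 t, γ' s ∈ closedBall (0 : E) R := fun s hs =>
    hR (Or.inr (mem_image_of_mem _ hs))
  obtain ⟨K, hK⟩ := hX.contDiffOn.exists_lipschitzOnWith one_ne_zero
    (convex_closedBall (0 : E) R) (isCompact_closedBall (0 : E) R)
  rcases le_total 0 t with ht | ht
  · have hI : uIcc 0 t = Icc 0 t := uIcc_of_le ht
    have hd : ∀ γ : ℝ → E, Solves X t γ → ∀ s ∈ Ico 0 t,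
        HasDerivWithinAt γ (X (γ s)) (Ici s) s := fun γ h s hs =>
      (h s (hI ▸ Ico_subset_Icc_self hs)).mono_of_mem_nhdsWithin
        (by rw [hI]; exact Icc_mem_nhdsGE_of_mem hs)
    have hs : ∀ s ∈ Ico 0 t, s ∈ uIcc 0 t := fun s hs => hI ▸ Ico_subset_Icc_self hs
    rw [hI]
    exact ODE_solution_unique_of_mem_Icc_right (v := fun _ => X) (s := fun _ => closedBall 0 R)
      (fun _ _ => hK) (hI ▸ h.continuousOn) (hd γ h) (fun s h => hγ s (hs s h))
      (hI ▸ h'.continuousOn) (hd γ' h') (fun s h => hγ' s (hs s h)) h0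
  · have hI : uIcc 0 t = Icc t 0 := uIcc_of_ge ht
    have hd : ∀ γ : ℝ → E, Solves X t γ → ∀ s ∈ Ioc t 0,
        HasDerivWithinAt γ (X (γ s)) (Iic s) s := fun γ h s hs =>
      (h s (hI ▸ Ioc_subset_Icc_self hs)).mono_of_mem_nhdsWithin
        (by rw [hI]; exact Icc_mem_nhdsLE_of_mem hs)
    have hs : ∀ s ∈ Ioc t 0, s ∈ uIcc 0 t := fun s hs => hI ▸ Ioc_subset_Icc_self hs
    rw [hI]
    exact ODE_solution_unique_of_mem_Icc_left (v := fun _ => X) (s := fun _ => closedBall 0 R)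
      (fun _ _ => hK) (hI ▸ h.continuousOn) (hd γ h) (fun s h => hγ s (hs s h))
      (hI ▸ h'.continuousOn) (hd γ' h') (fun s h => hγ' s (hs s h)) h0

/-- Solutions that start in a ball exist for a uniform time and stay in a slightly larger ball,
uniformly in a parameter. -/
lemma exists_uniform_time {X : ℝ → E → E} (hX : ContDiff ℝ 1 fun p : ℝ × E => X p.1 p.2)
    {R : ℝ} (hR : 0 ≤ R) : ∃ δ > (0 : ℝ), ∀ τ t : ℝ, |τ| ≤ 1 → |t| ≤ δ →
      ∀ z ∈ closedBall (0 : E) R, ∃ γ : ℝ → E, Solves (X τ) t γ ∧ γ 0 = z ∧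
        ∀ s ∈ uIcc 0 t, γ s ∈ closedBall (0 : E) (R + 1) := by
  obtain ⟨K, hK⟩ := exists_lipschitzOnWith_closedBall hX (R + 1)
  obtain ⟨L, hL⟩ := exists_norm_le_closedBall hX (R + 1)
  have hδ : (0 : ℝ) < 1 / (L + 1) := by positivity
  -- during a time `1 / (L + 1)` a curve of speed at most `L` moves by less than `1`
  refine ⟨1 / (L + 1), hδ, fun τ t hτ ht z hz => ?_⟩
  have hp : IsPicardLindelof (fun _ => X τ) (tmin := -(1 / (L + 1))) (tmax := 1 / (L + 1))
      ⟨0, by linarith, hδ.le⟩ 0 (.mk (R + 1) (by linarith)) (.mk R hR) L K := by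
    refine IsPicardLindelof.of_time_independent (hL τ hτ) (hK τ hτ) ?_
    simp only [sub_zero, zero_sub, neg_neg, max_self, NNReal.coe_mk]
    rw [mul_one_div, add_sub_cancel_left, div_le_one (by positivity)]
    linarith
  obtain ⟨α, h0, hα⟩ := exists_solution_mem_closedBall hp hz
  have hsub : uIcc 0 t ⊆ Icc (-(1 / (L + 1))) (1 / (L + 1) : ℝ) := by
    have := abs_le.1 ht
    exact uIcc_subset_Icc ⟨by linarith, hδ.le⟩ ⟨this.1, this.2⟩
  exact ⟨α, fun s hs => (hα s (hsub hs)).1.mono hsub, h0, fun s hs => (hα s (hsub hs)).2⟩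

/-- **Taylor expansion** of a function all of whose derivatives are given. -/
lemma taylor_bound (N : ℕ) {g : ℕ → ℝ → ℝ} {t C : ℝ}
    (hg : ∀ k, ∀ s ∈ uIcc 0 t, HasDerivWithinAt (g k) (g (k + 1) s) (uIcc 0 t) s)
    (hC : ∀ s ∈ uIcc 0 t, |g (N + 1) s| ≤ C) (s : ℝ) (hs : s ∈ uIcc 0 t) :
    |g 0 s - ∑ k ∈ Finset.range (N + 1), (k.factorial : ℝ)⁻¹ * s ^ k * g k 0|
      ≤ C * |s| ^ (N + 1) := by
  have mvt : ∀ (h h' : ℝ → ℝ) (A s : ℝ), s ∈ uIcc 0 t → h 0 = 0 →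
      (∀ r ∈ uIcc 0 t, HasDerivWithinAt h (h' r) (uIcc 0 t) r) →
      (∀ r ∈ uIcc 0 s, |h' r| ≤ A) → |h s| ≤ A * |s| := by
    intro h h' A s hs h0 hd hA
    have hsub : uIcc 0 s ⊆ uIcc 0 t := uIcc_subset_uIcc_left hs
    have := (convex_uIcc 0 s).norm_image_sub_le_of_norm_hasDerivWithin_le
      (fun r hr => (hd r (hsub hr)).mono hsub) hA left_mem_uIcc right_mem_uIcc
    simpa [h0] using this
  induction N generalizing g s with
  | zero =>
    have := mvt (fun r => g 0 r - g 0 0) (g 1) C s hs (sub_self _)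
      (fun r hr => (hg 0 r hr).sub_const _) fun r hr => hC r (uIcc_subset_uIcc_left hs hr)
    simpa using this
  | succ N ih =>
    have hC0 : 0 ≤ C := (abs_nonneg _).trans (hC s hs)
    have := mvt (fun r => g 0 r - ∑ k ∈ Finset.range (N + 2), (k.factorial : ℝ)⁻¹ * r ^ k * g k 0)
      (fun r => g 1 r - ∑ k ∈ Finset.range (N + 1), (k.factorial : ℝ)⁻¹ * r ^ k * g (k + 1) 0)
      (C * |s| ^ (N + 1)) s hs ?_ ?_ ?_
    · rwa [mul_assoc, ← pow_succ] at this
    · rw [Finset.sum_range_succ']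
      simp
    · intro r hr
      refine (hg 0 r hr).sub ?_
      simp_rw [Finset.sum_range_succ' _ (N + 1)]
      have hsum : HasDerivWithinAt
          (fun r => ∑ k ∈ Finset.range (N + 1),
            ((k + 1).factorial : ℝ)⁻¹ * r ^ (k + 1) * g (k + 1) 0)
          (∑ k ∈ Finset.range (N + 1), (k.factorial : ℝ)⁻¹ * r ^ k * g (k + 1) 0) (uIcc 0 t) r := by
        refine HasDerivWithinAt.fun_sum fun k _ => ?_
        have := (((hasDerivAt_pow (k + 1) r).const_mul ((k + 1).factorial : ℝ)⁻¹).mul_const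
          (g (k + 1) 0)).hasDerivWithinAt (s := uIcc 0 t)
        convert this using 2
        have : ((k : ℝ) + 1) ≠ 0 := by positivity
        rw [Nat.factorial_succ]
        push_cast
        rw [mul_inv]
        field_simp
      simpa using hsum.add_const (g 0 0)
    · intro r hr
      refine (ih (g := fun k => g (k + 1)) (fun k => hg (k + 1)) hC r
        (uIcc_subset_uIcc_left hs hr)).trans ?_
      have hrs : |r| ≤ |s| := by simpa using abs_sub_left_of_mem_uIcc hr
      gcongr

end ODE

/-! ### Operators of Hamiltonian flows -/

section Flows

open Polynomial Finset Sm Metric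

variable {n : ℕ}

/-- The position `q^a`. -/
def pos (a : Fin n) : Sm n := Sm.mk (fun z => z.1 a) (by fun_prop)

lemma norm_sub_le_of_coordinates {w w' : Phase n} {r : ℝ} (hr : 0 ≤ r)
    (hq : ∀ a, |pos a w - pos a w'| ≤ r) (hp : ∀ a, |mom a w - mom a w'| ≤ r) : ‖w - w'‖ ≤ r :=
  max_le ((pi_norm_le_iff_of_nonneg hr).2 hq) ((pi_norm_le_iff_of_nonneg hr).2 hp)

/-- The Hamiltonian `∑_{k ≤ K} τ ^ (2 k) f_k`. -/
def evenSum (K : ℕ) (f : ℕ → Sm n) (τ : ℝ) : Sm n := ∑ k ∈ range (K + 1), τ ^ (2 * k) • f k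

lemma contDiff_hamVF_evenSum (K : ℕ) (f : ℕ → Sm n) :
    ContDiff ℝ 1 fun p : ℝ × Phase n => hamVF (evenSum K f p.1) p.2 := by
  have key : ∀ g : ℕ → Sm n, ContDiff ℝ 1 fun p : ℝ × Phase n => evenSum K g p.1 p.2 := by
    intro g
    simp only [evenSum, sum_apply, smul_apply]
    refine ContDiff.sum fun k _ => (contDiff_fst.pow _).mul ?_
    exact ((Sm.contDiff (g k)).of_le (by simp)).comp contDiff_snd
  have hP : ∀ a τ, dP a (evenSum K f τ) = evenSum K (fun k => dP a (f k)) τ := fun a τ => by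
    simp [evenSum]
  have hQ : ∀ a τ, dQ a (evenSum K f τ) = evenSum K (fun k => dQ a (f k)) τ := fun a τ => by
    simp [evenSum]
  refine ContDiff.prodMk (contDiff_pi.2 fun a => ?_) (contDiff_pi.2 fun a => ?_)
  · simp only [← coe_dP, hP]
    exact key _
  · simp only [← coe_dQ, hQ]
    exact (key _).neg

lemma contDiff_hamVF (f : Sm n) : ContDiff ℝ 1 (hamVF f) := by
  have h := (contDiff_hamVF_evenSum 0 fun _ => f).comp
    (contDiff_prodMk_right (𝕜 := ℝ) (F := Phase n) (0 : ℝ))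
  have e : evenSum 0 (fun _ => f) 0 = f := by simp [evenSum]
  simpa only [Function.comp_def, e] using h

lemma fderiv_hamVF (F g : Sm n) (z : Phase n) : fderiv ℝ F z (hamVF g z) = L g F z := by
  have hv : ∀ v : Phase n, fderiv ℝ F z v = ∑ a, (v.1 a * dQ a F z + v.2 a * dP a F z) := by
    intro v
    have e : v = ∑ a, (v.1 a • ((Pi.single a 1, 0) : Phase n)
        + v.2 a • ((0, Pi.single a 1) : Phase n)) := by
      refine Prod.ext (funext fun b => ?_) (funext fun b => ?_)
      · simp [Prod.fst_sum, Finset.sum_apply, Pi.single_apply]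
      · simp [Prod.snd_sum, Finset.sum_apply, Pi.single_apply]
    conv_lhs => rw [e]
    simp only [map_sum, map_add, map_smul, smul_eq_mul]
    rfl
  rw [hv, L_apply, halfBr_apply, halfBr_apply, ← sum_sub_distrib, sum_apply]
  refine sum_congr rfl fun a _ => ?_
  simp only [hamVF, ← coe_dP, ← coe_dQ, sub_apply, mul_apply]
  ring

/-- A function changes along a Hamiltonian flow at the rate given by the Poisson bracket. -/
lemma Solves.hasDerivWithinAt_comp {g : Sm n} {t : ℝ} {γ : ℝ → Phase n}
    (h : Solves (hamVF g) t γ) (F : Sm n) (s : ℝ) (hs : s ∈ Set.uIcc 0 t) :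
    HasDerivWithinAt (fun r => F (γ r)) (L g F (γ s)) (Set.uIcc 0 t) s := by
  rw [← fderiv_hamVF]
  exact (differentiableAt F (γ s)).hasFDerivAt.comp_hasDerivWithinAt s (h s hs)

/-- The value of an operator polynomial at the real number `τ`. -/
def ev (τ : ℝ) : (Module.End ℝ (Sm n))[X] →ₐ[ℝ] Module.End ℝ (Sm n) :=
  eval₂AlgHom (AlgHom.id ℝ _) (algebraMap ℝ _ τ) fun A => (Algebra.commutes τ A).symm

lemma ev_monomial (τ : ℝ) (i : ℕ) (A : Module.End ℝ (Sm n)) :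
    ev τ (monomial i A) = τ ^ i • A := by
  change eval₂ (RingHom.id _) (algebraMap ℝ _ τ) (monomial i A) = _
  rw [eval₂_monomial, ← map_pow, ← Algebra.commutes, Algebra.smul_def]
  rfl

lemma ev_apply (τ : ℝ) (Q : (Module.End ℝ (Sm n))[X]) (F : Sm n) :
    ev τ Q F = ∑ i ∈ range (Q.natDegree + 1), τ ^ i • Q.coeff i F := by
  conv_lhs => rw [Q.as_sum_range]
  simp only [map_sum, ev_monomial, LinearMap.sum_apply, LinearMap.smul_apply]

lemma ev_oddPoly (K : ℕ) (f : ℕ → Sm n) (τ : ℝ) :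
    ev τ (oddPoly K f) = τ • L (evenSum K f τ) := by
  simp only [oddPoly, evenSum, map_sum, map_smul, smul_sum, ev_monomial, smul_smul]
  exact sum_congr rfl fun k _ => by rw [pow_succ']

lemma exists_bound_ev {Q : (Module.End ℝ (Sm n))[X]} {m : ℕ} (hQ : ∀ d < m, Q.coeff d = 0)
    (F : Sm n) (R : ℝ) : ∃ C, 0 ≤ C ∧ ∀ τ : ℝ, |τ| ≤ 1 → ∀ y ∈ closedBall (0 : Phase n) R,
      |ev τ Q F y| ≤ C * |τ| ^ m := by
  choose C hC using fun i => (isCompact_closedBall (0 : Phase n) R).exists_bound_of_continuousOn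
    (Sm.contDiff (Q.coeff i F)).continuous.continuousOn
  refine ⟨∑ i ∈ range (Q.natDegree + 1), |C i|, sum_nonneg fun _ _ => abs_nonneg _,
    fun τ hτ y hy => ?_⟩
  rw [ev_apply, sum_apply, sum_mul]
  refine (abs_sum_le_sum_abs _ _).trans (sum_le_sum fun i _ => ?_)
  rw [smul_apply, abs_mul, abs_pow, mul_comm]
  rcases lt_or_ge i m with h | h
  · rw [hQ i h]
    simp only [LinearMap.zero_apply, zero_apply, abs_zero, zero_mul]
    positivity
  · exact mul_le_mul ((hC i y hy).trans (le_abs_self _))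
      (pow_le_pow_of_le_one (abs_nonneg _) hτ h) (by positivity) (abs_nonneg _)

/-- Transport of a function along a Hamiltonian flow whose generator is an operator polynomial in
the step length: the flow acts as the exponential of the generator. -/
lemma exists_flow_expansion {P : (Module.End ℝ (Sm n))[X]} (hP0 : P.coeff 0 = 0) {g : ℝ → Sm n}
    {t : ℝ → ℝ} (hP : ∀ τ, ev τ P = t τ • L (g τ)) (N : ℕ) (Q : (Module.End ℝ (Sm n))[X])
    (F : Sm n) (R : ℝ) : ∃ C, ∀ τ : ℝ, |τ| ≤ 1 → ∀ γ : ℝ → Phase n,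
      Solves (hamVF (g τ)) (t τ) γ → (∀ s ∈ Set.uIcc 0 (t τ), γ s ∈ closedBall 0 R) →
      |ev τ Q F (γ (t τ)) - ev τ (expTrunc N P * Q) F (γ 0)| ≤ C * |τ| ^ (N + 1) := by
  obtain ⟨C, hC0, hC⟩ := exists_bound_ev (Q := P ^ (N + 1) * Q) (m := N + 1)
    (fun d hd => coeff_mul_eq_zero (j := 0) (coeff_pow_eq_zero hP0 (N + 1))
      (fun k hk => absurd hk (Nat.not_lt_zero k)) hd) F R
  refine ⟨C, fun τ hτ γ hγ hR => ?_⟩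
  set A := L (g τ)
  set G := ev τ Q F with hG
  have hT : ∀ C', (∀ s ∈ Set.uIcc 0 (t τ), |(A ^ (N + 1)) G (γ s)| ≤ C') →
      |G (γ (t τ)) - ev τ (expTrunc N P * Q) F (γ 0)| ≤ C' * |t τ| ^ (N + 1) := by
    intro C' hC'
    have h := taylor_bound N (g := fun k s => (A ^ k) G (γ s)) (fun k s hs => by
      have := hγ.hasDerivWithinAt_comp ((A ^ k) G) s hs
      rwa [pow_succ', Module.End.mul_apply]) hC' (t τ) Set.right_mem_uIcc
    have e : ev τ (expTrunc N P * Q) F (γ 0) =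
        ∑ k ∈ range (N + 1), (k.factorial : ℝ)⁻¹ * (t τ) ^ k * (A ^ k) G (γ 0) := by
      rw [map_mul, Module.End.mul_apply, expTrunc, map_sum, LinearMap.sum_apply, sum_apply]
      refine sum_congr rfl fun k _ => ?_
      rw [expTerm, map_smul, map_pow, hP, _root_.smul_pow, smul_smul, LinearMap.smul_apply,
        smul_apply]
    rwa [e]
  rcases eq_or_ne (t τ) 0 with h0 | h0
  · refine (hT |(A ^ (N + 1)) G (γ 0)| fun s hs => ?_).trans ?_
    · rw [h0, Set.uIcc_self, Set.mem_singleton_iff] at hs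
      rw [hs]
    · rw [h0, abs_zero, zero_pow (Nat.succ_ne_zero N), mul_zero]
      positivity
  · have hpos : 0 < |t τ| ^ (N + 1) := by positivity
    refine (hT (C * |τ| ^ (N + 1) / |t τ| ^ (N + 1)) fun s hs => ?_).trans_eq
      (div_mul_cancel₀ _ hpos.ne')
    rw [le_div_iff₀ hpos]
    have h := hC τ hτ (γ s) (hR s hs)
    rw [map_mul, map_pow, hP, _root_.smul_pow, Module.End.mul_apply, LinearMap.smul_apply,
      smul_apply, abs_mul, abs_pow, mul_comm] at h
    exact h

lemma FlowsTo.unique {f : Sm n} {t : ℝ} {z w w' : Phase n} (h : FlowsTo f t z w)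
    (h' : FlowsTo f t z w') : w = w' := by
  obtain ⟨γ, hγ, h0, rfl⟩ := h
  obtain ⟨γ', hγ', h0', rfl⟩ := h'
  exact Solves.eqOn (contDiff_hamVF f) hγ hγ' (h0.trans h0'.symm) Set.right_mem_uIcc

/-- The flows of the Hamiltonians `evenSum K f τ`, `|τ| ≤ 1`, are defined on a ball for a common
short time, during which they stay in a slightly larger ball. -/
lemma exists_flow_of_evenSum (K : ℕ) (f : ℕ → Sm n) {R : ℝ} (hR : 0 ≤ R) :
    ∃ δ > (0 : ℝ), ∀ τ t : ℝ, |τ| ≤ 1 → |t| ≤ δ → ∀ z ∈ closedBall (0 : Phase n) R,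
      ∃ γ : ℝ → Phase n, Solves (hamVF (evenSum K f τ)) t γ ∧ γ 0 = z ∧
        (∀ s ∈ Set.uIcc 0 t, γ s ∈ closedBall (0 : Phase n) (R + 1)) ∧
        FlowsTo (evenSum K f τ) t z (γ t) := by
  obtain ⟨δ, hδ, h⟩ :=
    exists_uniform_time (X := fun τ => hamVF (evenSum K f τ)) (contDiff_hamVF_evenSum K f) hR
  refine ⟨δ, hδ, fun τ t hτ ht z hz => ?_⟩
  obtain ⟨γ, hγ, h0, hb⟩ := h τ t hτ ht z hz
  exact ⟨γ, hγ, h0, hb, γ, hγ, h0, rfl⟩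

end Flows

/-! ### The local error -/

section LocalError

open Polynomial Finset Sm Metric

variable {n : ℕ} {M : Matrix (Fin n) (Fin n) ℝ} {V₀ : (Fin n → ℝ) → ℝ}

/-- The potential energy as a smooth function on phase space. -/
def potS (V₀ : (Fin n → ℝ) → ℝ) (hV : ContDiff ℝ ∞ V₀) : Sm n :=
  Sm.mk (pot V₀) (hV.comp contDiff_fst)

lemma isPot_potS (hV : ContDiff ℝ ∞ V₀) : IsPot (potS V₀ hV) := fun a => by
  refine Sm.ext fun z => ?_
  have hd : DifferentiableAt ℝ V₀ z.1 := hV.differentiable (by simp) z.1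
  have h : HasFDerivAt (potS V₀ hV : Phase n → ℝ)
      ((fderiv ℝ V₀ z.1).comp (ContinuousLinearMap.fst ℝ _ _)) z :=
    hd.hasFDerivAt.comp z hasFDerivAt_fst
  rw [dP, dir_apply, h.fderiv]
  simp

lemma evenSum_apply (K : ℕ) (f : ℕ → Sm n) (τ : ℝ) (z : Phase n) :
    evenSum K f τ z = f 0 z + ∑ k ∈ Icc 1 K, τ ^ (2 * k) * f k z := by
  have h : range (K + 1) = insert 0 (Icc 1 K) := by
    ext i
    simp only [mem_range, mem_insert, mem_Icc]
    omega
  rw [evenSum, h, sum_insert (by simp), add_apply, sum_apply]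
  simp

lemma Teff_eq (hV : ContDiff ℝ ∞ V₀) (K : ℕ) (τ : ℝ) :
    Teff M V₀ K τ = evenSum K (tS M (potS V₀ hV)) τ := by
  funext z
  rw [Teff, evenSum_apply, tS, coe_kinS]
  congr 1
  refine sum_congr rfl fun k hk => ?_
  rw [coe_tS M (V := potS V₀ hV) rfl k (mem_Icc.1 hk).1]

lemma Veff_eq (hV : ContDiff ℝ ∞ V₀) (K : ℕ) (τ : ℝ) :
    Veff M V₀ K τ = evenSum K (vS M (potS V₀ hV)) τ := by
  funext z
  rw [Veff, evenSum_apply, vS]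
  congr 1
  refine sum_congr rfl fun k hk => ?_
  rw [coe_vS M (V := potS V₀ hV) rfl k (mem_Icc.1 hk).1]

lemma ham_eq (hV : ContDiff ℝ ∞ V₀) : ham M V₀ = (kinS M + potS V₀ hV : Sm n) := by
  rw [coe_add, coe_kinS]
  rfl

lemma Step.unique (hV : ContDiff ℝ ∞ V₀) {K : ℕ} {τ : ℝ} {z w w' : Phase n}
    (h : Step M V₀ K τ z w) (h' : Step M V₀ K τ z w') : w = w' := by
  obtain ⟨z₁, z₂, h1, h2, h3⟩ := h
  obtain ⟨z₁', z₂', h1', h2', h3'⟩ := h'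
  rw [Veff_eq hV] at h1 h3 h1' h3'
  rw [Teff_eq hV] at h2 h2'
  obtain rfl := h1.unique h1'
  obtain rfl := h2.unique h2'
  exact h3.unique h3'

/-- On a ball, one step of the scheme and the exact flow are both defined for small step lengths,
and differ by a multiple of `|τ| ^ (N + 1)`. -/
lemma exists_local_error (hM : M.IsSymm) (hV : ContDiff ℝ ∞ V₀) {K N : ℕ}
    (hKN : (K = 1 ∧ N = 4) ∨ (K = 2 ∧ N = 6) ∨ (K = 3 ∧ N = 8)) {R : ℝ} (hR : 0 ≤ R) :
    ∃ τ₀ > (0 : ℝ), ∃ C, 0 ≤ C ∧ ∀ τ : ℝ, |τ| ≤ τ₀ → ∀ z ∈ closedBall (0 : Phase n) R,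
      ∃ w w', Step M V₀ K τ z w ∧ FlowsTo (ham M V₀) τ z w' ∧ ‖w - w'‖ ≤ C * |τ| ^ (N + 1) := by
  set V := potS V₀ hV
  set H := kinS M + V
  set W := kickPoly M V K
  set B := movePoly M V K
  set Z : (Module.End ℝ (Sm n))[X] := oddPoly 0 fun _ => H
  have hW0 : W.coeff 0 = 0 := coeff_zero_oddPoly K _
  have hB0 : B.coeff 0 = 0 := coeff_zero_oddPoly K _
  have hZ0 : Z.coeff 0 = 0 := coeff_zero_oddPoly 0 _
  have hWev : ∀ τ, ev τ W = (τ / 2) • L (evenSum K (vS M V) τ) := fun τ => by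
    have e : evenSum K (fun k => (1 / 2 : ℝ) • vS M V k) τ =
        (1 / 2 : ℝ) • evenSum K (vS M V) τ := by
      simp only [evenSum, smul_sum]
      exact sum_congr rfl fun k _ => smul_comm _ _ _
    refine (ev_oddPoly K _ τ).trans ?_
    rw [e, map_smul, smul_smul, mul_one_div]
  have hBev : ∀ τ, ev τ B = τ • L (evenSum K (tS M V) τ) := fun τ => ev_oddPoly K _ τ
  have hZev : ∀ τ, ev τ Z = τ • L (evenSum 0 (fun _ => H) τ) := fun τ => ev_oddPoly 0 _ τ
  have hH : ∀ τ, evenSum 0 (fun _ => H) τ = H := fun τ => by simp [evenSum]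
  -- the step and the flow have the same expansion
  have hcoef : ∀ d < N + 1, (symmProd N W B - expTrunc N Z).coeff d = 0 := by
    intro d hd
    have hZ1 : Z = monomial 1 (L H) := by simp [Z, oddPoly]
    have h2 : (expTrunc N Z).coeff d = ((d.factorial : ℝ)⁻¹) • L H ^ d := by
      simp only [expTrunc, expTerm, hZ1, monomial_pow, one_mul, finsetSum_coeff, coeff_smul,
        coeff_monomial]
      rw [sum_eq_single d]
      · rw [if_pos rfl]
      · intro k _ hk
        rw [if_neg hk, smul_zero]
      · intro h
        exact absurd (mem_range.2 hd) h
    rw [coeff_sub, isExpUpTo_scheme hM (isPot_potS hV) hKN d hd, h2, sub_self]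
  obtain ⟨δ₁, hδ₁, hf₁⟩ := exists_flow_of_evenSum K (vS M V) hR
  obtain ⟨δ₂, hδ₂, hf₂⟩ := exists_flow_of_evenSum K (tS M V) (R := R + 1) (by linarith)
  obtain ⟨δ₃, hδ₃, hf₃⟩ := exists_flow_of_evenSum K (vS M V) (R := R + 1 + 1) (by linarith)
  obtain ⟨δ₄, hδ₄, hf₄⟩ := exists_flow_of_evenSum 0 (fun _ => H) hR
  have hF : ∀ F : Sm n, ∃ C, ∀ τ : ℝ, |τ| ≤ 1 → ∀ γ₁ γ₂ γ₃ γ₄ : ℝ → Phase n,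
      Solves (hamVF (evenSum K (vS M V) τ)) (τ / 2) γ₁ →
      (∀ s ∈ Set.uIcc 0 (τ / 2), γ₁ s ∈ closedBall (0 : Phase n) (R + 1)) →
      Solves (hamVF (evenSum K (tS M V) τ)) τ γ₂ →
      (∀ s ∈ Set.uIcc 0 τ, γ₂ s ∈ closedBall (0 : Phase n) (R + 1 + 1)) →
      Solves (hamVF (evenSum K (vS M V) τ)) (τ / 2) γ₃ →
      (∀ s ∈ Set.uIcc 0 (τ / 2), γ₃ s ∈ closedBall (0 : Phase n) (R + 1 + 1 + 1)) →
      Solves (hamVF (evenSum 0 (fun _ => H) τ)) τ γ₄ →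
      (∀ s ∈ Set.uIcc 0 τ, γ₄ s ∈ closedBall (0 : Phase n) (R + 1)) →
      γ₁ 0 ∈ closedBall (0 : Phase n) R → γ₂ 0 = γ₁ (τ / 2) → γ₃ 0 = γ₂ τ → γ₄ 0 = γ₁ 0 →
      |F (γ₃ (τ / 2)) - F (γ₄ τ)| ≤ C * |τ| ^ (N + 1) := by
    intro F
    obtain ⟨C₃, h₃⟩ := exists_flow_expansion hW0 hWev N 1 F (R + 1 + 1 + 1)
    obtain ⟨C₂, h₂⟩ := exists_flow_expansion hB0 hBev N (expTrunc N W) F (R + 1 + 1)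
    obtain ⟨C₁, h₁⟩ := exists_flow_expansion hW0 hWev N (expTrunc N B * expTrunc N W) F (R + 1)
    obtain ⟨C₄, h₄⟩ := exists_flow_expansion hZ0 hZev N 1 F (R + 1)
    obtain ⟨C₅, -, h₅⟩ := exists_bound_ev hcoef F R
    refine ⟨C₁ + C₂ + C₃ + C₄ + C₅, fun τ hτ γ₁ γ₂ γ₃ γ₄ s₁ b₁ s₂ b₂ s₃ b₃ s₄ b₄ hz e₂ e₃ e₄ => ?_⟩
    -- the operators of the three substeps compose in the order opposite to that of the flows
    have e1 := h₁ τ hτ γ₁ s₁ b₁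
    have e2 := h₂ τ hτ γ₂ s₂ b₂
    have e3 := h₃ τ hτ γ₃ s₃ b₃
    have e4 := h₄ τ hτ γ₄ s₄ b₄
    have e5 := h₅ τ hτ _ hz
    rw [e₂] at e2
    rw [e₃] at e3
    rw [e₄] at e4
    have es := map_sub (ev τ) (symmProd N W B) (expTrunc N Z)
    rw [es, LinearMap.sub_apply, sub_apply, symmProd, mul_assoc] at e5
    simp only [mul_one, map_one, Module.End.one_apply] at e3 e4
    rw [abs_le] at *
    constructor <;> linarith
  choose Cq hCq using fun a => hF (pos a)
  choose Cp hCp using fun a => hF (mom a)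
  have hCn : 0 ≤ ∑ a, |Cq a| + ∑ a, |Cp a| := by positivity
  refine ⟨min 1 (min δ₁ (min δ₂ (min δ₃ δ₄))), by positivity, ∑ a, |Cq a| + ∑ a, |Cp a|, hCn,
    fun τ hτ z hz => ?_⟩
  simp only [le_min_iff] at hτ
  obtain ⟨hτ1, hτ2, hτ3, hτ4, hτ5⟩ := hτ
  have hhalf : |τ / 2| ≤ |τ| := by
    rw [abs_div, abs_two]
    linarith [abs_nonneg τ]
  obtain ⟨γ₁, s₁, i₁, b₁, f₁⟩ := hf₁ τ (τ / 2) hτ1 (hhalf.trans hτ2) z hz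
  obtain ⟨γ₂, s₂, i₂, b₂, f₂⟩ := hf₂ τ τ hτ1 hτ3 _ (b₁ _ Set.right_mem_uIcc)
  obtain ⟨γ₃, s₃, i₃, b₃, f₃⟩ := hf₃ τ (τ / 2) hτ1 (hhalf.trans hτ4) _ (b₂ _ Set.right_mem_uIcc)
  obtain ⟨γ₄, s₄, i₄, b₄, f₄⟩ := hf₄ τ τ hτ1 hτ5 z hz
  refine ⟨γ₃ (τ / 2), γ₄ τ, ⟨_, _, by rwa [Veff_eq hV], by rwa [Teff_eq hV], by rwa [Veff_eq hV]⟩,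
    by rw [ham_eq hV]; rwa [hH τ] at f₄,
    norm_sub_le_of_coordinates (by positivity) (fun a => ?_) fun a => ?_⟩
  · refine (hCq a τ hτ1 γ₁ γ₂ γ₃ γ₄ s₁ b₁ s₂ b₂ s₃ b₃ s₄ b₄ (i₁ ▸ hz) i₂ i₃
      (i₄.trans i₁.symm)).trans (mul_le_mul_of_nonneg_right ?_ (by positivity))
    have h1 := single_le_sum (f := fun a => |Cq a|) (fun _ _ => abs_nonneg _) (mem_univ a)
    have h2 : 0 ≤ ∑ a, |Cp a| := by positivity
    linarith [le_abs_self (Cq a)]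
  · refine (hCp a τ hτ1 γ₁ γ₂ γ₃ γ₄ s₁ b₁ s₂ b₂ s₃ b₃ s₄ b₄ (i₁ ▸ hz) i₂ i₃
      (i₄.trans i₁.symm)).trans (mul_le_mul_of_nonneg_right ?_ (by positivity))
    have h1 := single_le_sum (f := fun a => |Cp a|) (fun _ _ => abs_nonneg _) (mem_univ a)
    have h2 : 0 ≤ ∑ a, |Cq a| := by positivity
    linarith [le_abs_self (Cp a)]

theorem agreesToOrder (hM : M.IsSymm) (hV : ContDiff ℝ ∞ V₀) {K N : ℕ}
    (hKN : (K = 1 ∧ N = 4) ∨ (K = 2 ∧ N = 6) ∨ (K = 3 ∧ N = 8)) : AgreesToOrder M V₀ K N := by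
  intro S hS
  obtain ⟨R, hR⟩ := hS.isBounded.subset_closedBall (0 : Phase n)
  obtain ⟨τ₀, hτ₀, C, -, h⟩ := exists_local_error hM hV hKN (abs_nonneg R)
  refine ⟨τ₀, hτ₀, C, fun z hz τ hτ => ?_⟩
  obtain ⟨w, w', hs, hf, he⟩ := h τ hτ z (closedBall_subset_closedBall (le_abs_self R) (hR hz))
  have hs' : ∀ y, Step M V₀ K τ z y → y = w := fun y hy => Step.unique hV hy hs
  have hf' : ∀ y, FlowsTo (ham M V₀) τ z y → y = w' := fun y hy => by
    rw [ham_eq hV] at hy hf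
    exact hy.unique hf
  refine ⟨⟨w, hs, hs'⟩, ⟨w', hf, hf'⟩, fun y y' hy hy' => ?_⟩
  rwa [hs' y hy, hf' y' hy']

end LocalError

/-! ### The global error -/

section GlobalError

open Sm Metric Set

lemma Solves.shift {E : Type*} [NormedAddCommGroup E] [NormedSpace ℝ E] {X : E → E} {t a τ : ℝ}
    {γ : ℝ → E} (h : Solves X t γ) (ha : 0 ≤ a) (hτ : 0 ≤ τ) (hat : a + τ ≤ t) :
    Solves X τ fun s => γ (a + s) := by
  intro s hs
  have hm : MapsTo (fun s => a + s) (uIcc 0 τ) (uIcc 0 t) := fun s hs => by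
    rw [uIcc_of_le hτ] at hs
    rw [uIcc_of_le (by linarith)]
    exact ⟨by linarith [hs.1], by linarith [hs.2]⟩
  have h1 : HasDerivWithinAt (fun s => a + s) 1 (uIcc 0 τ) s :=
    (hasDerivWithinAt_id s _).const_add a
  have h2 := (h (a + s) (hm hs)).scomp s h1 hm
  rw [one_smul] at h2
  exact h2

variable {n : ℕ} {M : Matrix (Fin n) (Fin n) ℝ} {V₀ : (Fin n → ℝ) → ℝ}

/-- Gronwall's inequality: on a ball the flow expands distances at most exponentially. -/
lemma exists_flow_lipschitz (f : Sm n) {R : ℝ} (hR : 0 ≤ R) :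
    ∃ δ > (0 : ℝ), ∃ Λ, 0 ≤ Λ ∧ ∀ τ, 0 ≤ τ → τ ≤ δ → ∀ z ∈ closedBall (0 : Phase n) R,
      ∀ z' ∈ closedBall (0 : Phase n) R, ∀ w w', FlowsTo f τ z w → FlowsTo f τ z' w' →
        ‖w - w'‖ ≤ ‖z - z'‖ * Real.exp (Λ * τ) := by
  obtain ⟨δ, hδ, h⟩ := exists_flow_of_evenSum 0 (fun _ => f) hR
  obtain ⟨K, hK⟩ := (contDiff_hamVF f).contDiffOn.exists_lipschitzOnWith one_ne_zero
    (convex_closedBall (0 : Phase n) (R + 1)) (isCompact_closedBall (0 : Phase n) (R + 1))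
  refine ⟨δ, hδ, K, K.2, fun τ hτ0 hτ z hz z' hz' w w' hw hw' => ?_⟩
  have hf : evenSum 0 (fun _ => f) 0 = f := by simp [evenSum]
  have key : ∀ z ∈ closedBall (0 : Phase n) R, ∀ w, FlowsTo f τ z w → ∃ γ : ℝ → Phase n,
      γ 0 = z ∧ γ τ = w ∧ ContinuousOn γ (Icc 0 τ) ∧ ∀ s ∈ Ico 0 τ,
        HasDerivWithinAt γ (hamVF f (γ s)) (Ici s) s ∧ γ s ∈ closedBall (0 : Phase n) (R + 1) := by
    intro z hz w hw
    obtain ⟨γ, hγ, h0, hb, hF⟩ := h 0 τ (by simp) (by rwa [abs_of_nonneg hτ0]) z hz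
    rw [hf] at hγ hF
    have hI : uIcc 0 τ = Icc 0 τ := uIcc_of_le hτ0
    refine ⟨γ, h0, hF.unique hw, hI ▸ hγ.continuousOn, fun s hs => ⟨?_, ?_⟩⟩
    · exact (hγ s (hI ▸ Ico_subset_Icc_self hs)).mono_of_mem_nhdsWithin
        (by rw [hI]; exact Icc_mem_nhdsGE_of_mem hs)
    · exact hb s (hI ▸ Ico_subset_Icc_self hs)
  obtain ⟨γ, rfl, rfl, hc, hd⟩ := key z hz w hw
  obtain ⟨γ', rfl, rfl, hc', hd'⟩ := key z' hz' w' hw'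
  have := dist_le_of_trajectories_ODE_of_mem (v := fun _ => hamVF f)
    (s := fun _ => closedBall (0 : Phase n) (R + 1)) (fun _ _ => hK) hc (fun s hs => (hd s hs).1)
    (fun s hs => (hd s hs).2) hc' (fun s hs => (hd' s hs).1) (fun s hs => (hd' s hs).2) le_rfl τ
    (right_mem_Icc.2 hτ0)
  rwa [sub_zero, dist_eq_norm, dist_eq_norm] at this

theorem hasOrder (hM : M.IsSymm) (hV : ContDiff ℝ ∞ V₀) {K N : ℕ}
    (hKN : (K = 1 ∧ N = 4) ∨ (K = 2 ∧ N = 6) ∨ (K = 3 ∧ N = 8)) : HasOrder M V₀ K N := by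
  intro t γ ht hγ
  have hγc : ContinuousOn γ (uIcc 0 t) := fun s hs => (hγ s hs).continuousWithinAt
  obtain ⟨R', hR'⟩ := (isCompact_uIcc.image_of_continuousOn hγc).isBounded.subset_closedBall 0
  have hγR : ∀ s, 0 ≤ s → s ≤ t → ‖γ s‖ ≤ |R'| := fun s h0 h1 =>
    (mem_closedBall_zero_iff.1 (hR' (mem_image_of_mem γ
      (by rw [uIcc_of_le ht]; exact ⟨h0, h1⟩)))).trans (le_abs_self R')
  have hR : 0 ≤ |R'| + 1 := by positivity
  obtain ⟨τ₁, hτ₁, C, hC, hloc⟩ := exists_local_error hM hV hKN hR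
  obtain ⟨δ, hδ, Λ, hΛ, hlip⟩ := exists_flow_lipschitz (kinS M + potS V₀ hV) hR
  set C' := C * t * Real.exp (Λ * t) with hC'
  have hC'0 : 0 ≤ C' := by positivity
  refine ⟨min 1 (min τ₁ (min δ (1 / (C' + 1)))), by positivity, C', fun τ hτ0 hτ => ?_⟩
  simp only [le_min_iff] at hτ
  obtain ⟨hτ1, hττ₁, hτδ, hτC⟩ := hτ
  have hN : N ≠ 0 := by omega
  -- the numerical solution stays within distance `1` of the exact one, hence in the ball on which
  -- the local error and the expansion of the exact flow are controlled
  have hsmall : C' * τ ^ N ≤ 1 := by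
    calc C' * τ ^ N ≤ C' * τ := by
          gcongr
          exact pow_le_of_le_one hτ0.le hτ1 hN
      _ ≤ (C' + 1) * (1 / (C' + 1)) := by gcongr; linarith
      _ = 1 := mul_one_div_cancel (by positivity)
  have hglob : ∀ k : ℕ, (k : ℝ) * τ ≤ t →
      C * τ ^ (N + 1) * k * Real.exp (Λ * (k * τ)) ≤ C' * τ ^ N := fun k hk => by
    calc C * τ ^ (N + 1) * k * Real.exp (Λ * (k * τ))
        = C * (k * τ) * Real.exp (Λ * (k * τ)) * τ ^ N := by ring
      _ ≤ C' * τ ^ N := by rw [hC']; gcongr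
  -- each step adds the local error to the error propagated by the exact flow
  have herr : ∀ x : ℕ → Phase n, x 0 = γ 0 → ∀ k : ℕ, (k : ℝ) * τ ≤ t →
      (∀ j < k, Step M V₀ K τ (x j) (x (j + 1))) →
      ‖x k - γ (k * τ)‖ ≤ C * τ ^ (N + 1) * k * Real.exp (Λ * (k * τ)) := by
    intro x hx0 k
    induction k with
    | zero => simp [hx0]
    | succ k ih =>
      intro hk hstep
      push_cast at hk ⊢
      have hk' : (k : ℝ) * τ ≤ t := by linarith
      have hkτ : 0 ≤ (k : ℝ) * τ := by positivity
      have h1 := ih hk' fun j hj => hstep j (by omega)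
      have hγk := hγR _ hkτ hk'
      have hxR : x k ∈ closedBall (0 : Phase n) (|R'| + 1) := by
        rw [mem_closedBall_zero_iff]
        have := norm_le_norm_add_norm_sub' (x k) (γ (k * τ))
        linarith [h1.trans ((hglob k hk').trans hsmall)]
      have hγR' : γ (k * τ) ∈ closedBall (0 : Phase n) (|R'| + 1) := by
        rw [mem_closedBall_zero_iff]
        linarith
      obtain ⟨w, w', hs, hf, he⟩ := hloc τ (by rwa [abs_of_pos hτ0]) (x k) hxR
      rw [hs.unique hV (hstep k (Nat.lt_succ_self k)), abs_of_pos hτ0] at he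
      have hflow : FlowsTo (ham M V₀) τ (γ (k * τ)) (γ ((k + 1) * τ)) := by
        refine ⟨fun s => γ (k * τ + s), Solves.shift hγ hkτ hτ0.le (by linarith), by simp, ?_⟩
        change γ (k * τ + τ) = γ ((k + 1) * τ)
        congr 1
        ring
      rw [ham_eq hV] at hf hflow
      have h2 := hlip τ hτ0.le hτδ _ hxR _ hγR' _ _ hf hflow
      have hexp : Real.exp (Λ * ((k + 1) * τ)) = Real.exp (Λ * (k * τ)) * Real.exp (Λ * τ) := by
        rw [← Real.exp_add]
        congr 1
        ring
      have hone : 1 ≤ Real.exp (Λ * ((k + 1) * τ)) := Real.one_le_exp (by positivity)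
      calc ‖x (k + 1) - γ ((k + 1) * τ)‖
          ≤ ‖x (k + 1) - w'‖ + ‖w' - γ ((k + 1) * τ)‖ := norm_sub_le_norm_sub_add_norm_sub _ _ _
        _ ≤ C * τ ^ (N + 1) * 1
            + C * τ ^ (N + 1) * k * Real.exp (Λ * (k * τ)) * Real.exp (Λ * τ) := by
          rw [mul_one]
          exact add_le_add he (h2.trans (by gcongr))
        _ ≤ C * τ ^ (N + 1) * Real.exp (Λ * ((k + 1) * τ))
            + C * τ ^ (N + 1) * k * Real.exp (Λ * ((k + 1) * τ)) := by
          rw [mul_assoc _ (Real.exp _), ← hexp]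
          gcongr
        _ = C * τ ^ (N + 1) * (k + 1) * Real.exp (Λ * ((k + 1) * τ)) := by ring
  refine ⟨?_, fun x hx k hk => (herr x hx.1 k hk fun j hj => hx.2 j ?_).trans (hglob k hk)⟩
  · classical
    let x : ℕ → Phase n := fun k => Nat.rec (γ 0)
      (fun _ y => if h : ∃ w, Step M V₀ K τ y w then h.choose else 0) k
    have hx : ∀ k : ℕ, (k : ℝ) * τ ≤ t → ∀ j < k, Step M V₀ K τ (x j) (x (j + 1)) := by
      intro k
      induction k with
      | zero => exact fun _ j hj => absurd hj (Nat.not_lt_zero j)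
      | succ k ih =>
        intro hk j hj
        push_cast at hk
        have hk' : (k : ℝ) * τ ≤ t := by linarith
        rcases (Nat.lt_succ_iff.1 hj).lt_or_eq with hj | rfl
        · exact ih hk' j hj
        have h1 := (herr x rfl j hk' (ih hk')).trans ((hglob j hk').trans hsmall)
        have hex : ∃ w, Step M V₀ K τ (x j) w := by
          obtain ⟨w, -, hs, -⟩ := hloc τ (by rwa [abs_of_pos hτ0]) (x j) (by
            rw [mem_closedBall_zero_iff]
            have := norm_le_norm_add_norm_sub' (x j) (γ (j * τ))
            linarith [hγR _ (by positivity) hk'])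
          exact ⟨w, hs⟩
        have : x (j + 1) = hex.choose := dif_pos hex
        rw [this]
        exact hex.choose_spec
    exact ⟨x, rfl, fun k hk => hx (k + 1) (by exact_mod_cast hk) k (Nat.lt_succ_self k)⟩
  · have : ((j : ℝ) + 1) ≤ k := by exact_mod_cast hj
    nlinarith

end GlobalError

/-! ### The harmonic oscillator -/

section Oscillator

open Finset Sm Matrix

variable {n : ℕ}

lemma dir_pos (v : Phase n) (a : Fin n) : dir v (pos a) = algebraMap ℝ (Sm n) (v.1 a) := by
  refine Sm.ext fun z => ?_
  have h : (pos a : Phase n → ℝ) =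
      (ContinuousLinearMap.proj (R := ℝ) (φ := fun _ : Fin n => ℝ) a).comp
        (ContinuousLinearMap.fst ℝ (Fin n → ℝ) (Fin n → ℝ)) := rfl
  rw [dir_apply, h, ContinuousLinearMap.fderiv]
  rfl

lemma dP_pos (a b : Fin n) : dP a (pos b) = 0 := by simp [dP, dir_pos]

lemma dQ_pos (a b : Fin n) : dQ a (pos b) = if a = b then 1 else 0 := by
  rw [dQ, dir_pos]
  rcases eq_or_ne a b with rfl | h
  · simp
  · simp [h, h.symm]

/-- The quadratic form `½ qᵀ A q` of the positions. -/
def quadPos (A : Matrix (Fin n) (Fin n) ℝ) : Sm n :=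
  (1 / 2 : ℝ) • ∑ a, pos a * ∑ b, A a b • pos b

lemma coe_quadPos (A : Matrix (Fin n) (Fin n) ℝ) :
    (quadPos A : Phase n → ℝ) = pot fun q => (1 / 2) * (q ⬝ᵥ A.mulVec q) := by
  funext z
  simp [quadPos, pot, pos, dotProduct, Matrix.mulVec]

lemma contDiff_quadratic (A : Matrix (Fin n) (Fin n) ℝ) :
    ContDiff ℝ ∞ fun q : Fin n → ℝ => (1 / 2) * (q ⬝ᵥ A.mulVec q) := by
  simp only [dotProduct, Matrix.mulVec]
  fun_prop

lemma isPot_quadPos (A : Matrix (Fin n) (Fin n) ℝ) : IsPot (quadPos A) := fun a => by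
  simp [quadPos, dP_pos]

lemma dQ_quadPos {A : Matrix (Fin n) (Fin n) ℝ} (hA : A.IsSymm) (a : Fin n) :
    dQ a (quadPos A) = ∑ b, A a b • pos b := by
  have h : ∑ x, pos x * (A x a • (1 : Sm n)) = ∑ b, A a b • pos b :=
    sum_congr rfl fun b _ => by rw [hA.apply a b]; simp
  simp only [quadPos, Derivation.map_smul, map_sum, Derivation.leibniz, dQ_pos, smul_eq_mul,
    sum_add_distrib, smul_ite, smul_zero, mul_ite, mul_zero, mul_one, sum_ite_eq, mem_univ,
    if_true]
  change (1 / 2 : ℝ) • (∑ x, pos x * (A x a • (1 : Sm n)) + _) = _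
  rw [h, ← two_smul ℝ, smul_smul]
  norm_num

/-- The function `p · q`. -/
def momPos : Sm n := ∑ a, mom a * pos a

lemma dQ_momPos (a : Fin n) : dQ a (momPos : Sm n) = mom a := by
  simp [momPos, dQ_mom, dQ_pos]

lemma opD_momPos (M : Matrix (Fin n) (Fin n) ℝ) : opD M (momPos : Sm n) = (2 : ℝ) • kinS M := by
  simp only [opD_apply, dUp_apply, dQ_momPos, kinS, smul_smul]
  norm_num

section Calculus

variable {M A : Matrix (Fin n) (Fin n) ℝ} (hM : M.IsSymm) (hA : A.IsSymm) (hMA : M * A = 1)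
include hA hMA

lemma dUp_quadPos (a : Fin n) : dUp M a (quadPos A) = pos a := by
  have h : ∀ c, ∑ b, M a b * A b c = if a = c then 1 else 0 := fun c => by
    rw [← Matrix.mul_apply, hMA, Matrix.one_apply]
  simp only [dUp_apply, dQ_quadPos hA, smul_sum, smul_smul]
  rw [sum_comm]
  simp only [← sum_smul, h, ite_smul, one_smul, zero_smul, sum_ite_eq, mem_univ, if_true]

lemma opD_quadPos : opD M (quadPos A) = momPos := by
  simp only [opD_apply, dUp_quadPos hA hMA, momPos]

include hM

/-- The gradient product with the potential is the Euler operator in the positions. -/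
lemma grad_quadPos (f : Sm n) : grad M (quadPos A) f = ∑ a, pos a * dQ a f := by
  simp only [grad_apply, sum_dQ_mul_dUp hM, dUp_quadPos hA hMA]

lemma grad_quadPos_self : grad M (quadPos A) (quadPos A) = (2 : ℝ) • quadPos A := by
  rw [grad_quadPos hM hA hMA]
  simp only [dQ_quadPos hA]
  rw [quadPos, smul_smul]
  norm_num

lemma grad_quadPos_momPos : grad M (quadPos A) momPos = momPos := by
  rw [grad_quadPos hM hA hMA]
  simp only [dQ_momPos]
  exact sum_congr rfl fun a _ => mul_comm _ _

lemma grad_quadPos_kinS : grad M (quadPos A) (kinS M) = 0 := by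
  rw [grad_quadPos hM hA hMA]
  simp [dQ_kinS]

lemma exists_vS_quadPos (k : ℕ) : ∃ d : ℝ, vS M (quadPos A) k = d • quadPos A := by
  have h1 := grad_quadPos_self hM hA hMA
  match k with
  | 0 => exact ⟨1, (one_smul _ _).symm⟩
  | 1 => exact ⟨1 / 12, by rw [vS, h1]; module⟩
  | 2 => exact ⟨1 / 120, by rw [vS, h1, map_smul, h1]; module⟩
  | 3 =>
    have h2 : hess M (quadPos A) (quadPos A) (quadPos A) = (2 : ℝ) • quadPos A := by
      have h := grad_grad' hM (quadPos A) (quadPos A) (quadPos A)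
      rw [h1, map_smul, h1, ← two_smul ℝ] at h
      exact (smul_right_injective _ (two_ne_zero (α := ℝ)) h).symm
    have h0 : Dpow M (quadPos A) 0 = quadPos A := rfl
    refine ⟨17 / 20160, ?_⟩
    rw [vS_three hM, h0, h2, h1]
    simp only [map_smul, LinearMap.smul_apply, h1]
    module
  | k + 4 => exact ⟨0, (zero_smul _ _).symm⟩

/-- For the oscillator the kinetic corrections are those of the Taylor series of `sin τ / τ`. -/
lemma tS_quadPos {k : ℕ} (hk : k ≤ 3) :
    tS M (quadPos A) k = ((-1) ^ k / ((2 * k + 1).factorial : ℝ)) • kinS M := by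
  have h0 := opD_quadPos (M := M) hA hMA
  have h1 := opD_momPos M
  have h2 := opD_kinS hM
  have h3 := grad_quadPos_self hM hA hMA
  have h4 := grad_quadPos_momPos hM hA hMA
  have h5 := grad_quadPos_kinS hM hA hMA
  interval_cases k
  · simp [tS]
  · simp only [tS, h0, h1]
    norm_num [Nat.factorial]
    module
  · simp only [tS, h0, h1, h2, h4, h5, map_smul, Derivation.map_smul, smul_zero, map_zero]
    norm_num [Nat.factorial]
    module
  · simp only [tS, h0, h1, h2, h3, h4, h5, map_smul, Derivation.map_smul, smul_zero, map_zero]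
    norm_num [Nat.factorial]
    module

end Calculus

lemma hamVF_smul_kinS {M : Matrix (Fin n) (Fin n) ℝ} (hM : M.IsSymm) (c : ℝ) (z : Phase n) :
    hamVF (c • kinS M : Sm n) z = (c • M.mulVec z.2, 0) := by
  refine Prod.ext (funext fun a => ?_) (funext fun a => ?_)
  · simp [hamVF, ← coe_dP, dP_kinS hM, mom, Matrix.mulVec, dotProduct]
  · simp [hamVF, ← coe_dQ, dQ_kinS]

lemma hamVF_smul_quadPos {A : Matrix (Fin n) (Fin n) ℝ} (hA : A.IsSymm) (c : ℝ) (z : Phase n) :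
    hamVF (c • quadPos A : Sm n) z = (0, -(c • A.mulVec z.1)) := by
  refine Prod.ext (funext fun a => ?_) (funext fun a => ?_)
  · simp [hamVF, ← coe_dP, isPot_quadPos A a]
  · simp [hamVF, ← coe_dQ, dQ_quadPos hA, pos, Matrix.mulVec, dotProduct]

lemma flowsTo_smul_kinS {M : Matrix (Fin n) (Fin n) ℝ} (hM : M.IsSymm) (c t : ℝ) (q p : Fin n → ℝ) :
    FlowsTo (c • kinS M : Sm n) t (q, p) (q + (t * c) • M.mulVec p, p) := by
  refine ⟨fun s => (q + (s * c) • M.mulVec p, p), fun s _ => ?_, by simp, rfl⟩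
  rw [hamVF_smul_kinS hM]
  have h : HasDerivAt (fun s : ℝ => q + (s * c) • M.mulVec p) (c • M.mulVec p) s := by
    simpa using (((hasDerivAt_id s).mul_const c).smul_const (M.mulVec p)).const_add q
  exact (h.prodMk (hasDerivAt_const s p)).hasDerivWithinAt

lemma flowsTo_smul_quadPos {A : Matrix (Fin n) (Fin n) ℝ} (hA : A.IsSymm) (c t : ℝ)
    (q p : Fin n → ℝ) :
    FlowsTo (c • quadPos A : Sm n) t (q, p) (q, p - (t * c) • A.mulVec q) := by
  refine ⟨fun s => (q, p - (s * c) • A.mulVec q), fun s _ => ?_, by simp, rfl⟩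
  rw [hamVF_smul_quadPos hA]
  have h : HasDerivAt (fun s : ℝ => p - (s * c) • A.mulVec q) (-(c • A.mulVec q)) s := by
    simpa using (((hasDerivAt_id s).mul_const c).smul_const (A.mulVec q)).const_sub p
  exact ((hasDerivAt_const s q).prodMk h).hasDerivWithinAt

lemma flowsTo_oscillator {M A : Matrix (Fin n) (Fin n) ℝ} (hM : M.IsSymm) (hA : A.IsSymm)
    (hAM : A * M = 1) (t : ℝ) (p : Fin n → ℝ) :
    FlowsTo (kinS M + quadPos A : Sm n) t (0, p) (Real.sin t • M.mulVec p, Real.cos t • p) := by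
  refine ⟨fun s => (Real.sin s • M.mulVec p, Real.cos s • p), fun s _ => ?_, by simp, rfl⟩
  have hv : ∀ z, hamVF (kinS M + quadPos A : Sm n) z = (M.mulVec z.2, -A.mulVec z.1) := fun z => by
    have e1 := hamVF_smul_kinS hM 1 z
    have e2 := hamVF_smul_quadPos hA 1 z
    rw [one_smul, one_smul] at e1 e2
    have : hamVF (kinS M + quadPos A : Sm n) z = hamVF (kinS M) z + hamVF (quadPos A) z := by
      refine Prod.ext (funext fun a => ?_) (funext fun a => ?_)
      · simp [hamVF, ← coe_dP]
      · simp [hamVF, ← coe_dQ, add_comm]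
    rw [this, e1, e2]
    simp
  rw [hv]
  have h1 : HasDerivAt (fun s : ℝ => Real.sin s • M.mulVec p) (Real.cos s • M.mulVec p) s :=
    (Real.hasDerivAt_sin s).smul_const _
  have h2 : HasDerivAt (fun s : ℝ => Real.cos s • p) (-Real.sin s • p) s :=
    (Real.hasDerivAt_cos s).smul_const _
  have e : (M.mulVec (Real.cos s • p), -A.mulVec (Real.sin s • M.mulVec p)) =
      (Real.cos s • M.mulVec p, -Real.sin s • p) := by
    rw [Matrix.mulVec_smul, Matrix.mulVec_smul, Matrix.mulVec_mulVec, hAM, Matrix.one_mulVec,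
      neg_smul]
  rw [e]
  exact (h1.prodMk h2).hasDerivWithinAt

/-- The truncated Taylor series of the sine. -/
def sinTrunc (m : ℕ) (x : ℝ) : ℝ :=
  ∑ i ∈ range m, (-1) ^ i / ((2 * i + 1).factorial : ℝ) * x ^ (2 * i + 1)

lemma abs_sin_sub_sinTrunc_le (m : ℕ) (x : ℝ) :
    |Real.sin x - sinTrunc (m + 1) x| ≤ |x| ^ (2 * m + 2) := by
  have hsum : ∀ (m : ℕ) (f : ℕ → ℝ),
      ∑ k ∈ range (2 * m), f k = ∑ i ∈ range m, (f (2 * i) + f (2 * i + 1)) := by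
    intro m f
    induction m with
    | zero => simp
    | succ m ih =>
      rw [mul_add, mul_one, sum_range_succ, sum_range_succ, ih, sum_range_succ, add_assoc]
  have h := taylor_bound (2 * m + 1) (g := fun k => iteratedDeriv k Real.sin) (t := x) (C := 1)
    (fun k s _ => by
      rw [iteratedDeriv_succ]
      exact ((Real.contDiff_sin (n := ∞)).differentiable_iteratedDeriv k
        (by exact_mod_cast ENat.natCast_lt_top k) s).hasDerivAt.hasDerivWithinAt)
    (fun s _ => by
      rw [show 2 * m + 1 + 1 = 2 * (m + 1) by ring, Real.iteratedDeriv_even_sin]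
      simpa [abs_mul] using Real.abs_sin_le_one s) x Set.right_mem_uIcc
  rw [show 2 * m + 1 + 1 = 2 * (m + 1) by ring, hsum, one_mul] at h
  rw [mul_add, mul_one] at h
  convert h using 3
  · simp
  · rw [sinTrunc]
    refine sum_congr rfl fun i _ => ?_
    rw [Real.iteratedDeriv_even_sin, Real.iteratedDeriv_odd_sin]
    simp
    ring

lemma le_abs_sinTrunc_sub_sin (m : ℕ) {x : ℝ}
    (hx : |x| ≤ 1 / (2 * ((2 * m + 1).factorial : ℝ))) :
    1 / (2 * ((2 * m + 1).factorial : ℝ)) * |x| ^ (2 * m + 1) ≤ |sinTrunc m x - Real.sin x| := by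
  have h := abs_sin_sub_sinTrunc_le m x
  have hs : sinTrunc (m + 1) x =
      sinTrunc m x + (-1) ^ m / ((2 * m + 1).factorial : ℝ) * x ^ (2 * m + 1) :=
    sum_range_succ _ _
  set c : ℝ := ((2 * m + 1).factorial : ℝ) with hc
  have hc0 : 0 < c := by positivity
  have h1 : |(-1) ^ m / c * x ^ (2 * m + 1)| = 2 * (1 / (2 * c)) * |x| ^ (2 * m + 1) := by
    rw [abs_mul, abs_div, abs_pow, abs_pow, abs_neg, abs_one, one_pow, abs_of_pos hc0]
    field_simp
  have h2 : |x| ^ (2 * m + 2) ≤ 1 / (2 * c) * |x| ^ (2 * m + 1) := by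
    rw [pow_succ, mul_comm]
    gcongr
  have h3 : |(-1) ^ m / c * x ^ (2 * m + 1)| ≤
      |sinTrunc m x - Real.sin x| + |Real.sin x - sinTrunc (m + 1) x| := by
    rw [← abs_neg]
    refine le_trans (le_of_eq ?_) (abs_add_le _ _)
    rw [hs]
    congr 1
    ring
  linarith

lemma isSymm_of_posDef {M : Matrix (Fin n) (Fin n) ℝ} (hM : M.PosDef) : M.IsSymm := by
  have := hM.isHermitian
  rwa [Matrix.IsHermitian, Matrix.conjTranspose_eq_transpose_of_trivial] at this

/-- One step of the scheme for the oscillator, started at `q = 0`: the sine in the exact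
position is replaced by its Taylor polynomial. -/
lemma exists_step_oscillator {M A : Matrix (Fin n) (Fin n) ℝ} (hM : M.IsSymm) (hA : A.IsSymm)
    (hMA : M * A = 1) {K : ℕ} (hK : K ≤ 3) (τ : ℝ) (p : Fin n → ℝ) :
    ∃ p', Step M (fun q => (1 / 2) * (q ⬝ᵥ A.mulVec q)) K τ (0, p)
      (sinTrunc (K + 1) τ • M.mulVec p, p') := by
  have hV := contDiff_quadratic A
  have hpot : potS _ hV = quadPos A := DFunLike.coe_injective (coe_quadPos A).symm
  choose d hd using exists_vS_quadPos hM hA hMA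
  have hVeff : Veff M (fun q => (1 / 2) * (q ⬝ᵥ A.mulVec q)) K τ =
      ((∑ k ∈ range (K + 1), τ ^ (2 * k) * d k) • quadPos A : Sm n) := by
    rw [Veff_eq hV, hpot, evenSum, sum_smul]
    simp only [hd, smul_smul]
  have hTeff : Teff M (fun q => (1 / 2) * (q ⬝ᵥ A.mulVec q)) K τ =
      ((∑ k ∈ range (K + 1), τ ^ (2 * k) * ((-1) ^ k / ((2 * k + 1).factorial : ℝ))) •
        kinS M : Sm n) := by
    rw [Teff_eq hV, hpot, evenSum, sum_smul]
    congr 1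
    refine sum_congr rfl fun k hk => ?_
    rw [tS_quadPos hM hA hMA (by have := mem_range.1 hk; omega), smul_smul]
  have hsin : τ * ∑ k ∈ range (K + 1), τ ^ (2 * k) * ((-1) ^ k / ((2 * k + 1).factorial : ℝ)) =
      sinTrunc (K + 1) τ := by
    rw [sinTrunc, mul_sum]
    exact sum_congr rfl fun k _ => by ring
  refine ⟨p - (τ / 2 * ∑ k ∈ range (K + 1), τ ^ (2 * k) * d k) •
      A.mulVec (sinTrunc (K + 1) τ • M.mulVec p),
    (0, p), (sinTrunc (K + 1) τ • M.mulVec p, p), ?_, ?_, ?_⟩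
  · rw [hVeff]
    simpa using flowsTo_smul_quadPos hA (∑ k ∈ range (K + 1), τ ^ (2 * k) * d k) (τ / 2) 0 p
  · rw [hTeff]
    simpa [hsin] using flowsTo_smul_kinS hM
      (∑ k ∈ range (K + 1), τ ^ (2 * k) * ((-1) ^ k / ((2 * k + 1).factorial : ℝ))) τ 0 p
  · rw [hVeff]
    exact flowsTo_smul_quadPos hA _ (τ / 2) _ p

theorem differsAfterOrder_oscillator {M : Matrix (Fin n) (Fin n) ℝ} (hM : M.PosDef) (hn : 0 < n)
    {K N : ℕ} (hKN : (K = 1 ∧ N = 4) ∨ (K = 2 ∧ N = 6) ∨ (K = 3 ∧ N = 8)) :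
    DiffersAfterOrder M (fun q => (1 / 2) * (q ⬝ᵥ M⁻¹.mulVec q)) K N := by
  have hS := isSymm_of_posDef hM
  have hA : M⁻¹.IsSymm := by
    rw [Matrix.IsSymm, Matrix.transpose_nonsing_inv, hS]
  have hdet : IsUnit M.det := hM.det_pos.ne'.isUnit
  have hMA := Matrix.mul_nonsing_inv M hdet
  have hAM := Matrix.nonsing_inv_mul M hdet
  have hV := contDiff_quadratic M⁻¹
  have hpot : potS _ hV = quadPos M⁻¹ := DFunLike.coe_injective (coe_quadPos M⁻¹).symm
  set p : Fin n → ℝ := Pi.single ⟨0, hn⟩ 1 with hp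
  have hMp : 0 < ‖M.mulVec p‖ := by
    rw [norm_pos_iff]
    intro h
    have h1 : p = 0 := by rw [← Matrix.one_mulVec p, ← hAM, ← Matrix.mulVec_mulVec, h,
      Matrix.mulVec_zero]
    have h2 := congrFun h1 ⟨0, hn⟩
    simp [hp] at h2
  have hN : N + 1 = 2 * (K + 1) + 1 := by omega
  set c : ℝ := 1 / (2 * ((2 * (K + 1) + 1).factorial : ℝ)) with hc
  have hc0 : 0 < c := by positivity
  refine ⟨(0, p), c * ‖M.mulVec p‖, by positivity, c, hc0, fun τ _ hτ => ?_⟩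
  obtain ⟨p', hstep⟩ := exists_step_oscillator hS hA hMA (K := K) (by omega) τ p
  refine ⟨_, (Real.sin τ • M.mulVec p, Real.cos τ • p), hstep, ?_, le_trans ?_ (norm_fst_le _)⟩
  · rw [ham_eq hV, hpot]
    exact flowsTo_oscillator hS hA hAM τ p
  · rw [Prod.fst_sub, ← sub_smul, norm_smul, Real.norm_eq_abs, hN, mul_right_comm]
    exact mul_le_mul_of_nonneg_right (le_abs_sinTrunc_sub_sin (K + 1) hτ) (norm_nonneg _)

end Oscillator

end ModifiedSplitting

end

theorem mainTheorem3 (n : ℕ) (M : Matrix (Fin n) (Fin n) ℝ) (hM : M.PosDef)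
    (K N : ℕ) (hKN : (K = 1 ∧ N = 4) ∨ (K = 2 ∧ N = 6) ∨ (K = 3 ∧ N = 8)) :
    (∀ V : (Fin n → ℝ) → ℝ, ContDiff ℝ ∞ V →
      ModifiedSplitting.AgreesToOrder M V K N ∧ ModifiedSplitting.HasOrder M V K N) ∧
    (0 < n → ∃ V : (Fin n → ℝ) → ℝ, ContDiff ℝ ∞ V ∧
      ModifiedSplitting.DiffersAfterOrder M V K N) := by
  have hS := ModifiedSplitting.isSymm_of_posDef hM
  refine ⟨fun V hV => ⟨ModifiedSplitting.agreesToOrder hS hV hKN,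
    ModifiedSplitting.hasOrder hS hV hKN⟩, fun hn => ⟨_,
    ModifiedSplitting.contDiff_quadratic M⁻¹,
    ModifiedSplitting.differsAfterOrder_oscillator hM hn hKN⟩⟩
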